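/- Consider a game among $N\ge 2$ coalitions, coalition $i$ having $m_i\ge 2$ agents. Agent $j$ of coalition $i$ has action $x_{ij}\in\mathbb{R}$ and a $\mathcal{C}^2$ cost $f_{ij}:\mathbb{R}^{\sum_i m_i}\to\mathbb{R}$ of the whole profile $\mathbf{x}=(x_{ij})$; put $f_i=\sum_{j=1}^{m_i} f_{ij}$. Assume that the pseudo-gradient $\mathcal{P}(\mathbf{x})=\bigl(\partial f_i(\mathbf{x})/\partial x_{ik}\bigr)_{i,k}$ is strictly monotone, $(\mathbf{x}-\mathbf{y})^T(\mathcal{P}(\mathbf{x})-\mathcal{P}(\mathbf{y}))>0$ for all $\mathbf{x}\ne\mathbf{y}$, and that the game has a Nash equilibrium $\mathbf{x}^*$, i.e. $f_i(\mathbf{x}_i^*,\mathbf{x}_{-i}^*)\le f_i(\mathbf{x}_i,\mathbf{x}_{-i}^*)$ for all $i$ and all $\mathbf{x}_i\in\mathbb{R}^{m_i}$. In the (undirected) interference graph $\mathcal{G}_I^i$ on the agents of coalition $i$, distinct agents $j,k$ are neighbours iff $f_{ij}$ depends on $x_{ik}$ or $f_{ik}$ depends on $x_{ij}$. Let $S_{ik}$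 consist of agent $k$ and its neighbours in $\mathcal{G}_I^i$, and $n_{ik}=|S_{ik}|$. The agents of coalition $i$ communicate over a simple weighted graph $\mathcal{G}_C^i$ with adjacency matrix $(a_i^{jl})$, $a_i^{jl}\ge 0$, $a_i^{jj}=0$, and $\mathcal{G}_{C_k}^i$ is obtained from $\mathcal{G}_C^i$ by removing all nodes outside $S_{ik}$. Assume that all $\mathcal{G}_I^i$ are connected and that all $\mathcal{G}_{C_k}^i$ are undirected ($a_i^{jl}=a_i^{lj}$ for $j,l\in S_{ik}$) and connected. Fix constants $\bar d_{ij}>0$ and, for $\delta>0$, consider, for all $i$, $j$ and all $k$ with $j\in S_{ik}$, $$\dot x_{ij}=-\delta\bar d_{ij}\,g_{ijj},\qquad \dot w_{ijk}=-\sum_{l\in S_{ik}}a_i^{jl}(g_{ijk}-g_{ilk}),\qquad g_{ijk}=w_{ijk}+\frac{\partial f_{ij}(\mathbf{x})}{\partial x_{ik}},\qquad w_{ijk}(0)=0 .$$ For each $i,k$ let $R_{ik}\in\mathbb{R}^{n_{ik}\times(n_{ik}-1)}$ be a matrix such that $[\mathbf{1}/\sqrt{n_{ik}}\;\;R_{ik}]$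 is orthogonal, let $\bar G_{ik}=R_{ik}^T(g_{ijk})_{j\in S_{ik}}$, let $\bar G$ be the concatenation of all $\bar G_{ik}$, and let $\chi=[\bar G^T,(\mathbf{x}-\mathbf{x}^*)^T]^T$, with the Euclidean norm. Then there is a class-$\mathcal{KL}$ function $\phi$ such that for all $\Delta,v>0$ there is $\delta^*=\delta^*(\Delta,v)>0$ such that for every $\delta\in(0,\delta^*)$ and every initial profile $\mathbf{x}(0)$ with $\|\chi(0)\|<\Delta$, the dynamics have a solution on $[0,\infty)$, and every such solution satisfies $$\|\chi(t)\|\le\phi(\|\chi(0)\|,\delta t)+v\qquad\text{for all } t\ge 0 .$$ -/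

import Mathlib

namespace CoalitionGame

/-! ### The game -/

/-- The agents: `⟨i, j⟩` is agent `j` of coalition `i`; there are `N` coalitions and coalition `i`
has `m i` agents. -/
abbrev Agent {N : ℕ} (m : Fin N → ℕ) : Type := (i : Fin N) × Fin (m i)

/-- Action profiles `x = (x_{ij})`, with the Euclidean norm. -/
abbrev Profile {N : ℕ} (m : Fin N → ℕ) : Type := EuclideanSpace ℝ (Agent m)

/-- The agents' cost functions `f_{ij}`, each a function of the whole action profile. -/
abbrev Costs {N : ℕ} (m : Fin N → ℕ) : Type := (i : Fin N) → Fin (m i) → Profile m → ℝ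

variable {N : ℕ} {m : Fin N → ℕ}

/-- The partial derivative `∂h/∂x_p` at `x`. -/
noncomputable def partialDeriv (h : Profile m → ℝ) (p : Agent m) (x : Profile m) : ℝ :=
  fderiv ℝ h x (EuclideanSpace.single p 1)

/-- The cost `f_i = ∑_j f_{ij}` of coalition `i`. -/
def coalitionCost (f : Costs m) (i : Fin N) (x : Profile m) : ℝ := ∑ j, f i j x

/-- The pseudo-gradient: its entry at `⟨i, k⟩` is `∂f_i/∂x_{ik}`. -/
noncomputable def pseudoGradient (f : Costs m) (x : Profile m) : Profile m :=
  WithLp.toLp 2 fun p => partialDeriv (coalitionCost f p.1) p x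

/-- Strict monotonicity of the pseudo-gradient. -/
def IsStrictlyMonotone (f : Costs m) : Prop :=
  ∀ x y : Profile m, x ≠ y → 0 < inner ℝ (x - y) (pseudoGradient f x - pseudoGradient f y)

/-- `xs` is a (pure-strategy) Nash equilibrium: no coalition can lower its cost by changing the
actions of its own agents only. -/
def IsNashEquilibrium (f : Costs m) (xs : Profile m) : Prop :=
  ∀ (i : Fin N) (y : Profile m), (∀ p : Agent m, p.1 ≠ i → y p = xs p) →
    coalitionCost f i xs ≤ coalitionCost f i y

/-! ### Interference graphs -/

/-- The function `h` depends on the coordinate `x_p`. -/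
def DependsOnAction (h : Profile m → ℝ) (p : Agent m) : Prop :=
  ∃ x y : Profile m, (∀ q, q ≠ p → x q = y q) ∧ h x ≠ h y

/-- The interference graph of coalition `i`: distinct agents `j`, `k` are neighbours iff `f_{ij}`
depends on `x_{ik}` or `f_{ik}` depends on `x_{ij}`. -/
def interferenceGraph (f : Costs m) (i : Fin N) : SimpleGraph (Fin (m i)) where
  Adj j k := j ≠ k ∧ (DependsOnAction (f i j) ⟨i, k⟩ ∨ DependsOnAction (f i k) ⟨i, j⟩)
  symm := ⟨fun _ _ h => ⟨h.1.symm, h.2.symm⟩⟩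
  loopless := ⟨fun _ h => h.1 rfl⟩

open Classical in
/-- Agent `k` of coalition `i` together with its neighbours in the interference graph. -/
noncomputable def closedNbhd (f : Costs m) (i : Fin N) (k : Fin (m i)) : Finset (Fin (m i)) :=
  Finset.univ.filter fun j => j = k ∨ (interferenceGraph f i).Adj k j

/-! ### Communication graphs -/

/-- A simple weighted (possibly directed) graph: `weight u v` is the entry in row `u` and column
`v` of the adjacency matrix; it is positive iff there is an edge from `v` to `u`. -/
structure WeightedGraph (V : Type) where
  weight : V → V → ℝ
  nonneg : ∀ u v, 0 ≤ weight u v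
  loopless : ∀ u, weight u u = 0

/-- There is an edge from `u` to `v`. -/
def WeightedGraph.Edge {V : Type} (G : WeightedGraph V) (u v : V) : Prop := 0 < G.weight v u

/-- The adjacency matrix is symmetric. -/
def WeightedGraph.IsUndirected {V : Type} (G : WeightedGraph V) : Prop :=
  ∀ u v, G.weight u v = G.weight v u

/-- There is a path between any two vertices. -/
def WeightedGraph.IsConnected {V : Type} (G : WeightedGraph V) : Prop :=
  ∀ u v, Relation.ReflTransGen G.Edge u v

/-- The graph left after removing all nodes outside `S`. -/
def WeightedGraph.induce {V : Type} (G : WeightedGraph V) (S : Finset V) : WeightedGraph S where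
  weight u v := G.weight u v
  nonneg u v := G.nonneg u v
  loopless u := G.loopless u

/-- The interference-to-`k` communication graph of coalition `i`. -/
noncomputable def interferenceToGraph (f : Costs m) (C : (i : Fin N) → WeightedGraph (Fin (m i)))
    (i : Fin N) (k : Fin (m i)) : WeightedGraph (closedNbhd f i k) :=
  (C i).induce (closedNbhd f i k)

/-! ### The seeking strategy -/

/-- The values of the auxiliary variables: `w i k j` is `w_{ijk}`, for `j` equal to `k` or an
interference neighbour of `k` (equivalently, `k` equal to `j` or an interference neighbour
of `j`). -/
abbrev Aux (f : Costs m) : Type := (i : Fin N) → (k : Fin (m i)) → closedNbhd f i k → ℝ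

/-- `k` belongs to its closed neighbourhood. -/
theorem self_mem_closedNbhd (f : Costs m) (i : Fin N) (k : Fin (m i)) : k ∈ closedNbhd f i k := by
  simp [closedNbhd]

/-- The estimates `g_{ijk} = w_{ijk} + ∂f_{ij}(x)/∂x_{ik}`, written `estimate f x w i k j`. -/
noncomputable def estimate (f : Costs m) (x : Profile m) (w : Aux f) : Aux f :=
  fun i k j => w i k j + partialDeriv (f i j) ⟨i, k⟩ x

/-- `(x, w)` solves, for all times `t ≥ 0`, the seeking dynamics
`x_{ij}' = -δ d_{ij} g_{ijj}`, `w_{ijk}' = -∑_l a_i^{jl} (g_{ijk} - g_{ilk})`, where `l` runs over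
the closed interference neighbourhood of `k`, with initial values `x(0) = x₀`, `w(0) = 0`. -/
structure IsTrajectory (f : Costs m) (C : (i : Fin N) → WeightedGraph (Fin (m i)))
    (d : (i : Fin N) → Fin (m i) → ℝ) (δ : ℝ) (x₀ : Profile m)
    (x : ℝ → Profile m) (w : ℝ → Aux f) : Prop where
  x_init : x 0 = x₀
  w_init : w 0 = 0
  x_deriv : ∀ t, 0 ≤ t → ∀ (i : Fin N) (j : Fin (m i)),
    HasDerivWithinAt (fun s => x s ⟨i, j⟩)
      (-(δ * d i j) * estimate f (x t) (w t) i j ⟨j, self_mem_closedNbhd f i j⟩) (Set.Ici 0) t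
  w_deriv : ∀ t, 0 ≤ t → ∀ (i : Fin N) (k : Fin (m i)) (j : closedNbhd f i k),
    HasDerivWithinAt (fun s => w s i k j)
      (-∑ l : closedNbhd f i k, (C i).weight j l *
        (estimate f (x t) (w t) i k j - estimate f (x t) (w t) i k l)) (Set.Ici 0) t

/-! ### The error state -/

/-- `R` completes the normalized all-ones column to an orthogonal matrix `[𝟏/√n, R]`, `n` being
the number of rows. -/
def IsOrthogonalCompletion {V : Type} [Fintype V] [DecidableEq V]
    (R : Matrix V (Fin (Fintype.card V - 1)) ℝ) : Prop :=
  let U : Matrix V (Unit ⊕ Fin (Fintype.card V - 1)) ℝ :=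
    Matrix.fromCols (Matrix.of fun _ _ => 1 / √(Fintype.card V : ℝ)) R
  U.transpose * U = 1 ∧ U * U.transpose = 1

/-- A choice of a matrix `R_{ik}`, with `n - 1` columns where `n` is the number of nodes of the
interference-to-`k` graph, for every agent `⟨i, k⟩`. -/
abbrev Frames (f : Costs m) : Type :=
  (i : Fin N) → (k : Fin (m i)) →
    Matrix (closedNbhd f i k) (Fin (Fintype.card (closedNbhd f i k) - 1)) ℝ

/-- The consensus disagreement `Ḡ_{ik} = R_{ik}ᵀ G_{ik}`, where `G_{ik}` is the vector of the
`g_{ijk}` over `j` in the closed interference neighbourhood of `k`. -/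
noncomputable def disagreement (f : Costs m) (R : Frames f) (x : Profile m) (w : Aux f)
    (i : Fin N) (k : Fin (m i)) : Fin (Fintype.card (closedNbhd f i k) - 1) → ℝ :=
  Matrix.mulVec (R i k).transpose (estimate f x w i k)

/-- The error state `χ = (Ḡ, x - x*)`, with the Euclidean norm. -/
noncomputable def errorState (f : Costs m) (R : Frames f) (xs x : Profile m) (w : Aux f) :
    EuclideanSpace ℝ
      (((p : Agent m) × Fin (Fintype.card (closedNbhd f p.1 p.2) - 1)) ⊕ Agent m) :=
  WithLp.toLp 2 (Sum.elim (fun q => disagreement f R x w q.1.1 q.1.2 q.2) fun p => x p - xs p)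

/-- Class `KL` functions on `[0, ∞) × [0, ∞)`. -/
structure IsClassKL (φ : ℝ → ℝ → ℝ) : Prop where
  continuousOn : ContinuousOn (Function.uncurry φ) (Set.Ici 0 ×ˢ Set.Ici 0)
  zero_left : ∀ s, 0 ≤ s → φ 0 s = 0
  strictMonoOn : ∀ s, 0 ≤ s → StrictMonoOn (fun r => φ r s) (Set.Ici 0)
  antitoneOn : ∀ r, 0 ≤ r → AntitoneOn (φ r) (Set.Ici 0)
  tendsto_zero : ∀ r, 0 ≤ r → Filter.Tendsto (φ r) Filter.atTop (nhds 0)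

end CoalitionGame

open CoalitionGame

namespace CoalitionGame

open Set Filter Topology

/-! ### An explicit class-`KL` envelope -/

/-- The largest function below all `max s (r - τ a(s))`, `s > 0`. A scalar quantity that starts at
`r` and decreases at rate at least `a s` while it exceeds `s` stays below it. -/
noncomputable def decayEnvelope (a : ℝ → ℝ) (r τ : ℝ) : ℝ :=
  ⨅ s : Ioi (0 : ℝ), max (s : ℝ) (r - τ * a s)

theorem bddBelow_decayEnvelope (a : ℝ → ℝ) (r τ : ℝ) :
    BddBelow (range fun s : Ioi (0 : ℝ) => max (s : ℝ) (r - τ * a s)) := by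
  refine ⟨0, ?_⟩
  rintro _ ⟨s, rfl⟩
  exact le_max_of_le_left (le_of_lt s.2)

theorem decayEnvelope_le (a : ℝ → ℝ) (r τ : ℝ) {s : ℝ} (hs : 0 < s) :
    decayEnvelope a r τ ≤ max s (r - τ * a s) :=
  ciInf_le (bddBelow_decayEnvelope a r τ) (⟨s, hs⟩ : Ioi (0 : ℝ))

theorem le_decayEnvelope {a : ℝ → ℝ} {r τ y : ℝ} (h : ∀ s, 0 < s → y ≤ max s (r - τ * a s)) :
    y ≤ decayEnvelope a r τ :=
  le_ciInf fun s => h s s.2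

theorem decayEnvelope_nonneg (a : ℝ → ℝ) (r τ : ℝ) : 0 ≤ decayEnvelope a r τ :=
  le_decayEnvelope fun _ hs => le_max_of_le_left hs.le

theorem decayEnvelope_zero_left {a : ℝ → ℝ} (ha : ∀ s, 0 < s → 0 < a s) {τ : ℝ} (hτ : 0 ≤ τ) :
    decayEnvelope a 0 τ = 0 := by
  refine le_antisymm (le_of_forall_pos_le_add fun s hs => ?_) (decayEnvelope_nonneg _ _ _)
  refine (decayEnvelope_le a 0 τ hs).trans ?_
  have := mul_nonneg hτ (ha s hs).le
  rw [max_eq_left] <;> linarith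

theorem decayEnvelope_mono_left (a : ℝ → ℝ) (τ : ℝ) : Monotone fun r => decayEnvelope a r τ := by
  intro r r' h
  refine le_decayEnvelope fun s hs => (decayEnvelope_le a r τ hs).trans ?_
  exact max_le_max le_rfl (by linarith)

theorem decayEnvelope_antitone {a : ℝ → ℝ} (ha : ∀ s, 0 < s → 0 < a s) (r : ℝ) :
    Antitone (decayEnvelope a r) := by
  intro τ τ' h
  refine le_decayEnvelope fun s hs => (decayEnvelope_le a r τ' hs).trans ?_
  exact max_le_max le_rfl (by nlinarith [ha s hs])

theorem decayEnvelope_le_self (a : ℝ → ℝ) {r : ℝ} (hr : 0 ≤ r) {τ : ℝ} (hτ : 0 ≤ τ)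
    (ha : ∀ s, 0 < s → 0 < a s) : decayEnvelope a r τ ≤ r := by
  refine le_of_forall_pos_le_add fun s hs => ?_
  refine (decayEnvelope_le a r τ (add_pos_of_nonneg_of_pos hr hs)).trans ?_
  have := mul_nonneg hτ (ha _ (add_pos_of_nonneg_of_pos hr hs)).le
  exact max_le le_rfl (by linarith)

theorem decayEnvelope_lipschitz {a : ℝ → ℝ} (ha : ∀ s, 0 < s → 0 < a s)
    (ha1 : ∀ s, a s ≤ 1) : LipschitzWith 2 (Function.uncurry (decayEnvelope a)) := by
  refine LipschitzWith.of_le_add_mul 2 ?_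
  rintro ⟨r, τ⟩ ⟨r', τ'⟩
  rw [← sub_le_iff_le_add]
  refine le_decayEnvelope fun s hs => ?_
  rw [sub_le_iff_le_add]
  refine (decayEnvelope_le a r τ hs).trans ?_
  have hd : 0 ≤ dist (r, τ) (r', τ') := dist_nonneg
  have h1 : |r - r'| ≤ dist (r, τ) (r', τ') := le_max_left (dist r r') (dist τ τ')
  have h2 : |τ - τ'| ≤ dist (r, τ) (r', τ') := le_max_right (dist r r') (dist τ τ')
  have h3 : (τ' - τ) * a s ≤ |τ - τ'| := by
    have := ha s hs
    have := ha1 s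
    nlinarith [neg_abs_le (τ - τ'), abs_nonneg (τ - τ')]
  have h4 := le_abs_self (r - r')
  push_cast
  refine max_le ?_ ?_
  · linarith [le_max_left s (r' - τ' * a s)]
  · linarith [le_max_right s (r' - τ' * a s)]

theorem tendsto_decayEnvelope {a : ℝ → ℝ} (ha : ∀ s, 0 < s → 0 < a s) (r : ℝ) :
    Tendsto (decayEnvelope a r) atTop (𝓝 0) := by
  rw [Metric.tendsto_atTop]
  intro ε hε
  have hε2 := half_pos hε
  refine ⟨r / a (ε / 2), fun τ hτ => ?_⟩
  rw [Real.dist_eq, sub_zero, abs_of_nonneg (decayEnvelope_nonneg _ _ _)]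
  refine (decayEnvelope_le a r τ hε2).trans_lt ?_
  rw [ge_iff_le, div_le_iff₀ (ha _ hε2)] at hτ
  exact max_lt (by linarith) (by linarith)

/-! ### Scalar differential inequalities -/

theorem sqrt_add_le_add_sqrt {x y : ℝ} (hx : 0 ≤ x) (hy : 0 ≤ y) : √(x + y) ≤ √x + √y := by
  refine Real.sqrt_le_iff.2 ⟨by positivity, ?_⟩
  nlinarith [Real.sq_sqrt hx, Real.sq_sqrt hy, mul_nonneg (Real.sqrt_nonneg x) (Real.sqrt_nonneg y)]

theorem continuousOn_of_forall_hasDerivWithinAt {E : Type*} [NormedAddCommGroup E]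
    [NormedSpace ℝ E] {z z' : ℝ → E} {T : ℝ}
    (hz : ∀ t ∈ Icc 0 T, HasDerivWithinAt z (z' t) (Ici 0) t) : ContinuousOn z (Icc 0 T) :=
  fun t ht => (hz t ht).continuousWithinAt.mono Icc_subset_Ici_self

theorem le_of_hasDerivWithinAt_nonpos {y y' : ℝ → ℝ} {t₁ t₂ : ℝ} (h0 : 0 ≤ t₁) (h12 : t₁ ≤ t₂)
    (hy : ∀ t ∈ Icc t₁ t₂, HasDerivWithinAt y (y' t) (Ici 0) t)
    (hy' : ∀ t ∈ Ioo t₁ t₂, y' t ≤ 0) : y t₂ ≤ y t₁ := by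
  have hsub : Icc t₁ t₂ ⊆ Ici 0 := fun t ht => h0.trans ht.1
  refine antitoneOn_of_hasDerivWithinAt_nonpos (f' := y') (convex_Icc t₁ t₂)
    (fun t ht => (hy t ht).continuousWithinAt.mono hsub) (fun t ht => ?_) (fun t ht => ?_)
    (left_mem_Icc.2 h12) (right_mem_Icc.2 h12) h12
  · exact (hy t (interior_subset ht)).mono (interior_subset.trans hsub)
  · rw [interior_Icc] at ht
    exact hy' t ht

/-- Closed barriers: a continuous function that is strictly below `M` whenever it has been at most
`M` so far stays below `M`. -/
theorem lt_of_forall_le_imp_lt {h : ℝ → ℝ} {T M : ℝ} (hc : ContinuousOn h (Icc 0 T))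
    (hstep : ∀ t ∈ Icc 0 T, (∀ τ ∈ Ico 0 t, h τ ≤ M) → h t < M) :
    ∀ t ∈ Icc 0 T, h t < M := by
  by_contra! hcon
  obtain ⟨t, ht, htM⟩ := hcon
  set A : Set ℝ := Icc 0 T ∩ h ⁻¹' Ici M with hA
  have hAc : IsClosed A := hc.preimage_isClosed_of_isClosed isClosed_Icc isClosed_Ici
  have hAb : BddBelow A := ⟨0, fun _ hx => hx.1.1⟩
  have hmem : sInf A ∈ A := hAc.csInf_mem ⟨t, ht, htM⟩ hAb
  have := hstep (sInf A) hmem.1 fun τ hτ => by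
    by_contra! hlt
    exact absurd (csInf_le hAb (show τ ∈ A from ⟨⟨hτ.1, hτ.2.le.trans hmem.1.2⟩, hlt.le⟩))
      (not_le.2 hτ.2)
  exact absurd hmem.2 (not_le.2 this)

theorem gronwall_exp_decay {U U' : ℝ → ℝ} {T μ κ : ℝ} (hμ : 0 < μ)
    (hU : ∀ t ∈ Icc 0 T, HasDerivWithinAt U (U' t) (Ici 0) t)
    (hle : ∀ t ∈ Ico 0 T, U' t ≤ -μ * U t + κ) (hκ : 0 ≤ κ) (hT : 0 ≤ T) :
    U T ≤ U 0 * Real.exp (-μ * T) + κ / μ := by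
  have key := le_of_hasDerivWithinAt_nonpos (y := fun t => (U t - κ / μ) * Real.exp (μ * t))
    (y' := fun t => U' t * Real.exp (μ * t) + (U t - κ / μ) * (Real.exp (μ * t) * μ)) le_rfl hT
    (fun t ht => by
      have h1 : HasDerivAt (fun t : ℝ => μ * t) μ t := by
        simpa using (hasDerivAt_id t).const_mul μ
      exact ((hU t ht).sub_const _).mul h1.exp.hasDerivWithinAt)
    (fun t ht => by
      have h1 := hle t ⟨ht.1.le, ht.2⟩
      have h2 : U' t + (U t - κ / μ) * μ ≤ 0 := by
        have : κ / μ * μ = κ := by field_simp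
        linarith
      have := mul_nonpos_of_nonpos_of_nonneg h2 (Real.exp_pos (μ * t)).le
      linarith)
  simp only [mul_zero, Real.exp_zero, mul_one] at key
  have he : Real.exp (μ * T) * Real.exp (-μ * T) = 1 := by
    rw [← Real.exp_add]; simp
  have h3 := mul_le_mul_of_nonneg_right key (Real.exp_pos (-μ * T)).le
  rw [mul_assoc, he] at h3
  have h4 : 0 ≤ κ / μ * Real.exp (-μ * T) :=
    mul_nonneg (div_nonneg hκ hμ.le) (Real.exp_pos _).le
  linarith

/-- If `V` decreases at rate `δ a(V)` above the level `s₀`, up to an exponentially decaying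
perturbation, then `V` follows the decay envelope up to `s₀` and the size of the perturbation. -/
theorem le_decayEnvelope_add {V V' a : ℝ → ℝ} {T δ μ c s₀ : ℝ} (hT : 0 ≤ T) (hδ : 0 ≤ δ)
    (hμ : 0 < μ) (hc : 0 ≤ c) (hs₀ : 0 < s₀) (ha : Monotone a) (ha0 : ∀ s, 0 < s → 0 < a s)
    (hV : ∀ t ∈ Icc 0 T, HasDerivWithinAt V (V' t) (Ici 0) t)
    (hle : ∀ t ∈ Ico 0 T, s₀ ≤ V t → V' t ≤ -δ * a (V t) + c * Real.exp (-μ * t)) :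
    V T ≤ decayEnvelope a (V 0) (δ * T) + (s₀ + c / μ) := by
  have hVc : ContinuousOn V (Icc 0 T) := continuousOn_of_forall_hasDerivWithinAt hV
  have drop : ∀ s, s₀ ≤ s → ∀ t₁ ∈ Icc 0 T, (∀ t ∈ Ioo t₁ T, s ≤ V t) →
      V T ≤ V t₁ - δ * (T - t₁) * a s + c / μ := by
    intro s hs t₁ ht₁ habove
    have key := le_of_hasDerivWithinAt_nonpos
      (y := fun t => V t + δ * a s * t + c / μ * Real.exp (-μ * t))
      (y' := fun t => V' t + δ * a s * 1 + c / μ * (Real.exp (-μ * t) * -μ)) ht₁.1 ht₁.2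
      (fun t ht => by
        have h1 : HasDerivAt (fun t : ℝ => -μ * t) (-μ) t := by
          simpa using (hasDerivAt_id t).const_mul (-μ)
        exact ((hV t ⟨ht₁.1.trans ht.1, ht.2⟩).add
          ((hasDerivAt_id t).const_mul _).hasDerivWithinAt).add
          (h1.exp.const_mul _).hasDerivWithinAt)
      (fun t ht => by
        have h1 := hle t ⟨ht₁.1.trans ht.1.le, ht.2⟩ (hs.trans (habove t ht))
        have h2 := mul_le_mul_of_nonneg_left (ha (habove t ht)) hδ
        have h3 : c / μ * (Real.exp (-μ * t) * -μ) = -(c * Real.exp (-μ * t)) := by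
          field_simp
        rw [h3]
        linarith)
    have hcμ : 0 ≤ c / μ := div_nonneg hc hμ.le
    have h4 : 0 ≤ c / μ * Real.exp (-μ * T) := mul_nonneg hcμ (Real.exp_pos _).le
    have h5 : c / μ * Real.exp (-μ * t₁) ≤ c / μ * 1 := by
      refine mul_le_mul_of_nonneg_left (Real.exp_le_one_iff.2 ?_) hcμ
      nlinarith [ht₁.1]
    linarith
  have main : ∀ s, s₀ ≤ s → V T ≤ max s (V 0 - δ * T * a s) + c / μ := by
    intro s hs
    have hcμ : 0 ≤ c / μ := div_nonneg hc hμ.le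
    set A : Set ℝ := Icc 0 T ∩ V ⁻¹' Iic s with hA
    have hAc : IsClosed A := hVc.preimage_isClosed_of_isClosed isClosed_Icc isClosed_Iic
    have hAb : BddAbove A := ⟨T, fun _ hx => hx.1.2⟩
    rcases A.eq_empty_or_nonempty with hAe | hAn
    · have := drop s hs 0 ⟨le_rfl, hT⟩ fun t ht => by
        by_contra! hlt
        exact (hAe ▸ (show t ∈ A from ⟨⟨ht.1.le, ht.2.le⟩, hlt.le⟩) : t ∈ (∅ : Set ℝ))
      rw [sub_zero] at this
      linarith [le_max_right s (V 0 - δ * T * a s)]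
    · have hmem : sSup A ∈ A := hAc.csSup_mem hAn hAb
      have := drop s hs (sSup A) hmem.1 fun t ht => by
        by_contra! hlt
        exact absurd (le_csSup hAb (show t ∈ A from
          ⟨⟨hmem.1.1.trans ht.1.le, ht.2.le⟩, hlt.le⟩)) (not_le.2 ht.1)
      have h1 : V (sSup A) ≤ s := hmem.2
      have h2 : 0 ≤ δ * (T - sSup A) * a s :=
        mul_nonneg (mul_nonneg hδ (sub_nonneg.2 hmem.1.2)) (ha0 s (hs₀.trans_le hs)).le
      linarith [le_max_left s (V 0 - δ * T * a s)]
  rw [← sub_le_iff_le_add]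
  refine le_decayEnvelope fun s hs => ?_
  rcases le_total s₀ s with h | h
  · linarith [main s h]
  · have h1 := main s₀ le_rfl
    have h2 : δ * T * a s ≤ δ * T * a s₀ := mul_le_mul_of_nonneg_left (ha h) (mul_nonneg hδ hT)
    have h3 : max s₀ (V 0 - δ * T * a s₀) ≤ max s (V 0 - δ * T * a s) + s₀ :=
      max_le (by linarith [le_max_left s (V 0 - δ * T * a s)])
        (by linarith [le_max_right s (V 0 - δ * T * a s)])
    linarith

/-! ### Global existence -/

theorem exists_global_solution_of_lipschitz {E : Type*} [NormedAddCommGroup E] [NormedSpace ℝ E]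
    [CompleteSpace E] {F : E → E} {K B : NNReal} (hF : LipschitzWith K F) (hB : ∀ z, ‖F z‖ ≤ B)
    (z₀ : E) :
    ∃ z : ℝ → E, z 0 = z₀ ∧ ∀ t, 0 ≤ t → HasDerivWithinAt z (F (z t)) (Ici 0) t := by
  have hloc : ∀ T : ℝ, 0 ≤ T → ∃ z : ℝ → E, z 0 = z₀ ∧
      ∀ t ∈ Icc 0 T, HasDerivWithinAt z (F (z t)) (Icc 0 T) t := by
    intro T hT
    have hpl : IsPicardLindelof (fun _ => F) (⟨0, le_rfl, hT⟩ : Icc (0 : ℝ) T) z₀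
        (B * T.toNNReal) 0 B K :=
      { lipschitzOnWith := fun _ _ => hF.lipschitzOnWith
        continuousOn := fun _ _ => continuousOn_const
        norm_le := fun _ _ z _ => hB z
        mul_max_le := by simp [hT] }
    exact hpl.exists_eq_forall_mem_Icc_hasDerivWithinAt₀
  choose! α hα0 hα using hloc
  have hagree : ∀ S T, 0 ≤ S → S ≤ T → ∀ t ∈ Icc 0 S, α S t = α T t := by
    intro S T hS hST
    have hright : ∀ R, S ≤ R → ∀ t ∈ Ico 0 S, HasDerivWithinAt (α R) (F (α R t)) (Ici t) t := by
      intro R hR t ht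
      refine (hα R (hS.trans hR) t ⟨ht.1, ht.2.le.trans hR⟩).mono_of_mem_nhdsWithin ?_
      exact mem_of_superset (Icc_mem_nhdsGE (ht.2.trans_le hR)) (Icc_subset_Icc_left ht.1)
    have hcont : ∀ R, S ≤ R → ContinuousOn (α R) (Icc 0 S) := fun R hR t ht =>
      ((hα R (hS.trans hR) t ⟨ht.1, ht.2.trans hR⟩).continuousWithinAt).mono
        (Icc_subset_Icc_right hR)
    exact ODE_solution_unique (v := fun _ => F) (fun _ => hF) (hcont S le_rfl) (hright S le_rfl)
      (hcont T hST) (hright T hST) (by rw [hα0 S hS, hα0 T (hS.trans hST)])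
  refine ⟨fun t => α (t + 1) t, hα0 _ (by norm_num), fun t ht => ?_⟩
  have h1 : HasDerivWithinAt (α (t + 1)) (F (α (t + 1) t)) (Ici 0) t := by
    refine (hα (t + 1) (by linarith) t ⟨ht, by linarith⟩).mono_of_mem_nhdsWithin ?_
    rw [← Ici_inter_Iic]
    exact inter_mem self_mem_nhdsWithin (mem_nhdsWithin_of_mem_nhds (Iic_mem_nhds (by linarith)))
  refine h1.congr_of_eventuallyEq ?_ rfl
  have h2 : ∀ᶠ s in 𝓝[Ici 0] t, s < t + 1 :=
    mem_nhdsWithin_of_mem_nhds (Iio_mem_nhds (by linarith))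
  filter_upwards [h2, self_mem_nhdsWithin] with s hs hs0
  rw [mem_Ici] at hs0
  rcases le_total s t with h | h
  · exact hagree _ _ (by linarith) (by linarith) s ⟨hs0, by linarith⟩
  · exact (hagree _ _ (by linarith) (by linarith) s ⟨hs0, hs.le⟩).symm

/-- A `C¹` vector field has a global forward solution from `z₀` if every solution on a bounded
interval stays in a fixed ball. -/
theorem exists_global_solution_of_apriori_bound {E : Type*} [NormedAddCommGroup E]
    [NormedSpace ℝ E] [FiniteDimensional ℝ E] {F : E → E} (hF : ContDiff ℝ 1 F) {z₀ : E} {ρ : ℝ}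
    (hbound : ∀ (z : ℝ → E) (T : ℝ), 0 ≤ T → z 0 = z₀ →
      (∀ t ∈ Icc 0 T, HasDerivWithinAt z (F (z t)) (Ici 0) t) → ‖z T‖ ≤ ρ)
    (hz₀ : ‖z₀‖ ≤ ρ) :
    ∃ z : ℝ → E, z 0 = z₀ ∧ ∀ t, 0 ≤ t → HasDerivWithinAt z (F (z t)) (Ici 0) t := by
  have hρ : 0 ≤ ρ := (norm_nonneg _).trans hz₀
  let b : ContDiffBump (0 : E) := ⟨ρ + 1, ρ + 2, by linarith, by linarith⟩
  have hG : ContDiff ℝ 1 (fun z => b z • F z) := b.contDiff.smul hF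
  have hGs : HasCompactSupport (fun z => b z • F z) := b.hasCompactSupport.smul_right
  obtain ⟨K, hK⟩ := ContDiff.lipschitzWith_of_hasCompactSupport hGs hG one_ne_zero
  obtain ⟨B, hB⟩ := hGs.exists_bound_of_continuous hG.continuous
  obtain ⟨z, hz0, hz⟩ := exists_global_solution_of_lipschitz (B := B.toNNReal) hK
    (fun z => (hB z).trans (Real.le_coe_toNNReal B)) z₀
  have htrue : ∀ t, 0 ≤ t → ‖z t‖ ≤ ρ + 1 → HasDerivWithinAt z (F (z t)) (Ici 0) t := by
    intro t ht hle
    have h := hz t ht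
    rwa [b.one_of_mem_closedBall (by simpa using hle), one_smul] at h
  have hlt : ∀ t, 0 ≤ t → ‖z t‖ < ρ + 1 := by
    intro T hT
    have hzc : ContinuousOn z (Icc 0 T) :=
      continuousOn_of_forall_hasDerivWithinAt fun t ht => hz t ht.1
    refine lt_of_forall_le_imp_lt (h := fun t => ‖z t‖) hzc.norm (fun t ht hτ => ?_) T ⟨hT, le_rfl⟩
    have hle : ∀ s ∈ Icc 0 t, ‖z s‖ ≤ ρ + 1 := by
      intro s hs
      rcases hs.2.lt_or_eq with h | h
      · exact hτ s ⟨hs.1, h⟩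
      · rcases hs.1.eq_or_lt with h0 | h0
        · rw [← h0, hz0]; linarith
        · have hcl : s ∈ closure (Ico 0 s) := by
            rw [closure_Ico h0.ne]; exact ⟨hs.1, le_rfl⟩
          have hcw : ContinuousWithinAt (fun t => ‖z t‖) (Ico 0 s) s :=
            ((hz s hs.1).continuousWithinAt.mono (fun x hx => hx.1)).norm
          exact hcw.closure_le hcl continuousWithinAt_const fun y hy => hτ y (h ▸ hy)
    have := hbound z t ht.1 hz0 fun s hs => htrue s hs.1 (hle s hs)
    linarith
  exact ⟨z, hz0, fun t ht => htrue t ht (hlt t ht).le⟩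

/-- Two-time-scale stability for `z' = δ F₁(z) + F₂(z)` on an invariant set `S`: `U` decays under the
fast field `F₂`, `V` is constant along `F₂` and decreases along `F₁` up to an error controlled
by `U`. -/
theorem semiglobal_practical_stability {E : Type*} [NormedAddCommGroup E] [NormedSpace ℝ E]
    [FiniteDimensional ℝ E] {F₁ F₂ : E → E} (hF₁ : ContDiff ℝ 1 F₁) (hF₂ : ContDiff ℝ 1 F₂)
    {S : Set E}
    (hS : ∀ (δ : ℝ) (z : ℝ → E) (T : ℝ), 0 ≤ T → z 0 ∈ S →
      (∀ t ∈ Icc 0 T, HasDerivWithinAt z (δ • F₁ (z t) + F₂ (z t)) (Ici 0) t) → z T ∈ S)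
    {U V : E → ℝ} (hUd : ContDiff ℝ 1 U) (hVd : ContDiff ℝ 1 V) (hU0 : ∀ z, 0 ≤ U z)
    (hV0 : ∀ z, 0 ≤ V z) {μ : ℝ} (hμ : 0 < μ)
    (hUF₂ : ∀ z ∈ S, fderiv ℝ U z (F₂ z) ≤ -μ * U z) (hVF₂ : ∀ z ∈ S, fderiv ℝ V z (F₂ z) ≤ 0)
    {a : ℝ → ℝ} (ha : Monotone a) (ha0 : ∀ s, 0 < s → 0 < a s)
    (hVF₁ : ∀ M, ∃ c, 0 ≤ c ∧ ∀ z ∈ S, V z ≤ M → fderiv ℝ V z (F₁ z) ≤ -a (V z) + c * √(U z))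
    (hbdd : ∀ M, ∃ ρ, ∀ z ∈ S, V z ≤ M → U z ≤ M → ‖z‖ ≤ ρ)
    (Δ v : ℝ) (hΔ : 0 < Δ) (hv : 0 < v) :
    ∃ δs : ℝ, 0 < δs ∧ ∀ δ : ℝ, 0 < δ → δ < δs → ∀ z₀ ∈ S, V z₀ ≤ Δ → U z₀ ≤ Δ →
      (∃ z : ℝ → E, z 0 = z₀ ∧
        ∀ t, 0 ≤ t → HasDerivWithinAt z (δ • F₁ (z t) + F₂ (z t)) (Ici 0) t) ∧
      ∀ z : ℝ → E, z 0 = z₀ →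
        (∀ t, 0 ≤ t → HasDerivWithinAt z (δ • F₁ (z t) + F₂ (z t)) (Ici 0) t) →
        ∀ t, 0 ≤ t → V (z t) ≤ decayEnvelope (fun s => a s / 2) (V z₀) (δ * t) + v ∧
          U (z t) ≤ U z₀ * Real.exp (-μ * t) + v := by
  obtain ⟨v', hv', hv'v, hv'1⟩ : ∃ v', 0 < v' ∧ v' ≤ v ∧ v' ≤ 1 :=
    ⟨min v 1, lt_min hv one_pos, min_le_left _ _, min_le_right _ _⟩
  obtain ⟨ρ, hρ⟩ := hbdd (Δ + 2)
  obtain ⟨c, hc, hcV⟩ := hVF₁ (Δ + 2)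
  obtain ⟨K, hK0, hK⟩ : ∃ K, 0 ≤ K ∧ ∀ z, ‖z‖ ≤ ρ → fderiv ℝ U z (F₁ z) ≤ K := by
    have hcont : Continuous fun z => fderiv ℝ U z (F₁ z) :=
      (hUd.continuous_fderiv one_ne_zero).clm_apply hF₁.continuous
    obtain ⟨K, hK⟩ := (isCompact_closedBall (0 : E) ρ).exists_bound_of_continuousOn
      hcont.continuousOn
    refine ⟨max K 0, le_max_right _ _, fun z hz => ?_⟩
    exact (le_abs_self _).trans ((hK z (by simpa using hz)).trans (le_max_left _ _))
  obtain ⟨δs, hδs, hsmall⟩ : ∃ δs : ℝ, 0 < δs ∧ ∀ δ, 0 < δ → δ < δs →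
      δ * K / μ < v' ∧ δ * (c * √Δ) / (μ / 2) < v' / 2 ∧
        c * √(δ * K / μ) < a (v' / 2) / 2 := by
    have e1 : ∀ᶠ δ : ℝ in 𝓝 0, δ * K / μ < v' := by
      have : Continuous fun δ : ℝ => δ * K / μ := by fun_prop
      exact this.continuousAt.eventually_lt continuousAt_const (by simpa using hv')
    have e2 : ∀ᶠ δ : ℝ in 𝓝 0, δ * (c * √Δ) / (μ / 2) < v' / 2 := by
      have : Continuous fun δ : ℝ => δ * (c * √Δ) / (μ / 2) := by fun_prop
      exact this.continuousAt.eventually_lt continuousAt_const (by simpa using hv')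
    have e3 : ∀ᶠ δ : ℝ in 𝓝 0, c * √(δ * K / μ) < a (v' / 2) / 2 := by
      have : Continuous fun δ : ℝ => c * √(δ * K / μ) := by fun_prop
      exact this.continuousAt.eventually_lt continuousAt_const
        (by simpa using ha0 _ (half_pos hv'))
    obtain ⟨ε, hε, h⟩ := Metric.eventually_nhds_iff.1 (e1.and (e2.and e3))
    refine ⟨ε, hε, fun δ h0 h1 => h ?_⟩
    rwa [Real.dist_eq, sub_zero, abs_of_pos h0]
  refine ⟨δs, hδs, fun δ hδ hδlt z₀ hz₀ hVz₀ hUz₀ => ?_⟩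
  obtain ⟨hs1, hs2, hs3⟩ := hsmall δ hδ hδlt
  have henv : ∀ τ, 0 ≤ τ → decayEnvelope (fun s => a s / 2) (V z₀) τ ≤ V z₀ := fun τ hτ =>
    decayEnvelope_le_self _ (hV0 z₀) hτ fun s hs => half_pos (ha0 s hs)
  have ha_half : Monotone fun s => a s / 2 := fun x y hxy =>
    div_le_div_of_nonneg_right (ha hxy) zero_le_two
  have apriori : ∀ (z : ℝ → E) (T : ℝ), 0 ≤ T → z 0 = z₀ →
      (∀ t ∈ Icc 0 T, HasDerivWithinAt z (δ • F₁ (z t) + F₂ (z t)) (Ici 0) t) →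
      z T ∈ S ∧ V (z T) ≤ decayEnvelope (fun s => a s / 2) (V z₀) (δ * T) + v' ∧
        U (z T) ≤ U z₀ * Real.exp (-μ * T) + v' := by
    intro z T hT hz0 hz
    have hzS : ∀ t ∈ Icc 0 T, z t ∈ S := fun t ht =>
      hS δ z t ht.1 (hz0 ▸ hz₀) fun s hs => hz s ⟨hs.1, hs.2.trans ht.2⟩
    have hder : ∀ {W : E → ℝ}, ContDiff ℝ 1 W → ∀ t ∈ Icc 0 T,
        HasDerivWithinAt (fun t => W (z t))
          (δ * fderiv ℝ W (z t) (F₁ (z t)) + fderiv ℝ W (z t) (F₂ (z t))) (Ici 0) t := by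
      intro W hW t ht
      have := ((hW.differentiable one_ne_zero (z t)).hasFDerivAt).comp_hasDerivWithinAt t (hz t ht)
      simpa [Function.comp_def] using this
    have hzc : ContinuousOn z (Icc 0 T) := continuousOn_of_forall_hasDerivWithinAt hz
    have est : ∀ t ∈ Icc 0 T, (∀ τ ∈ Ico 0 t, V (z τ) ≤ Δ + 2 ∧ U (z τ) ≤ Δ + 2) →
        V (z t) ≤ decayEnvelope (fun s => a s / 2) (V z₀) (δ * t) + v' ∧
          U (z t) ≤ U z₀ * Real.exp (-μ * t) + v' := by
      intro t ht hbox
      have hUest : ∀ s ∈ Icc 0 t, U (z s) ≤ U z₀ * Real.exp (-μ * s) + δ * K / μ := by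
        intro s hs
        have := gronwall_exp_decay (U := fun t => U (z t)) (T := s) (κ := δ * K) hμ
          (fun r hr => hder hUd r ⟨hr.1, hr.2.trans (hs.2.trans ht.2)⟩) (fun r hr => ?_)
          (by positivity) hs.1
        · simpa [hz0] using this
        · have hrS := hzS r ⟨hr.1, hr.2.le.trans (hs.2.trans ht.2)⟩
          obtain ⟨hb1, hb2⟩ := hbox r ⟨hr.1, hr.2.trans_le hs.2⟩
          have h1 := hUF₂ _ hrS
          have h2 := mul_le_mul_of_nonneg_left (hK _ (hρ _ hrS hb1 hb2)) hδ.le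
          linarith
      refine ⟨?_, (hUest t ⟨ht.1, le_rfl⟩).trans (by linarith)⟩
      have := le_decayEnvelope_add (V := fun t => V (z t)) (T := t) (a := fun s => a s / 2)
        (δ := δ) (μ := μ / 2) (c := δ * (c * √Δ)) (s₀ := v' / 2) ht.1 hδ.le (half_pos hμ)
        (by positivity) (half_pos hv') ha_half (fun s hs => half_pos (ha0 s hs))
        (fun r hr => hder hVd r ⟨hr.1, hr.2.trans ht.2⟩) (fun r hr hsr => ?_)
      · simp only [hz0] at this
        linarith
      · have hrS := hzS r ⟨hr.1, hr.2.le.trans ht.2⟩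
        obtain ⟨hb1, hb2⟩ := hbox r hr
        have h1 := hVF₂ _ hrS
        have h2 := hcV _ hrS hb1
        have h3 : √(U (z r)) ≤ √Δ * Real.exp (-(μ / 2) * r) + √(δ * K / μ) := by
          have hle : U (z r) ≤ Δ * Real.exp (-μ * r) + δ * K / μ :=
            (hUest r ⟨hr.1, hr.2.le⟩).trans (by gcongr)
          refine (Real.sqrt_le_sqrt hle).trans ((sqrt_add_le_add_sqrt
            (by positivity) (by positivity)).trans ?_)
          rw [Real.sqrt_mul hΔ.le]
          have : √(Real.exp (-μ * r)) = Real.exp (-(μ / 2) * r) := by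
            rw [← Real.exp_half]; congr 1; ring
          rw [this]
        have h4 : a (v' / 2) ≤ a (V (z r)) := ha hsr
        have h5 := mul_le_mul_of_nonneg_left h3 hc
        have h6 : fderiv ℝ V (z r) (F₁ (z r)) ≤
            -(a (V (z r)) / 2) + c * √Δ * Real.exp (-(μ / 2) * r) := by
          linarith
        have h7 := mul_le_mul_of_nonneg_left h6 hδ.le
        linarith
    have hbox : ∀ t ∈ Icc 0 T, max (V (z t)) (U (z t)) < Δ + 2 := by
      refine lt_of_forall_le_imp_lt ?_ fun t ht hτ => ?_
      · exact (hVd.continuous.max hUd.continuous).comp_continuousOn hzc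
      · obtain ⟨h1, h2⟩ := est t ht fun τ h => max_le_iff.1 (hτ τ h)
        have h3 := henv (δ * t) (mul_nonneg hδ.le ht.1)
        have h4 : U z₀ * Real.exp (-μ * t) ≤ U z₀ * 1 := by
          refine mul_le_mul_of_nonneg_left (Real.exp_le_one_iff.2 ?_) (hU0 z₀)
          nlinarith [ht.1]
        exact max_lt (by linarith) (by linarith)
    exact ⟨hzS T ⟨hT, le_rfl⟩, est T ⟨hT, le_rfl⟩ fun τ hτ =>
      max_le_iff.1 (hbox τ ⟨hτ.1, hτ.2.le⟩).le⟩
  constructor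
  · have hball : ∀ z ∈ S, V z ≤ V z₀ + v' → U z ≤ U z₀ + v' → ‖z‖ ≤ ρ := fun z hz h1 h2 =>
      hρ z hz (by linarith) (by linarith)
    refine exists_global_solution_of_apriori_bound (F := fun z => δ • F₁ z + F₂ z)
      ((hF₁.const_smul δ).add hF₂) (ρ := ρ) (fun z T hT hz0 hz => ?_)
      (hball z₀ hz₀ (by linarith) (by linarith))
    obtain ⟨h0, h1, h2⟩ := apriori z T hT hz0 hz
    have h3 := henv (δ * T) (mul_nonneg hδ.le hT)
    have h4 : U z₀ * Real.exp (-μ * T) ≤ U z₀ * 1 := by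
      refine mul_le_mul_of_nonneg_left (Real.exp_le_one_iff.2 ?_) (hU0 z₀)
      nlinarith
    exact hball _ h0 (by linarith) (by linarith)
  · intro z hz0 hz t ht
    obtain ⟨-, h1, h2⟩ := apriori z t ht hz0 fun s hs => hz s hs.1
    exact ⟨by linarith, by linarith⟩

/-! ### The pseudo-gradient -/

section Game

variable {N : ℕ} {m : Fin N → ℕ}

theorem contDiff_partialDeriv {h : Profile m → ℝ} (hh : ContDiff ℝ 2 h) (p : Agent m) :
    ContDiff ℝ 1 (partialDeriv h p) :=
  (hh.fderiv_right (m := 1) (by norm_num)).clm_apply contDiff_const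

theorem partialDeriv_eq_zero {h : Profile m → ℝ} (hh : Differentiable ℝ h) {p : Agent m}
    (hp : ¬ DependsOnAction h p) (x : Profile m) : partialDeriv h p x = 0 := by
  have h1 : HasDerivAt (fun s : ℝ => h (x + s • EuclideanSpace.single p (1 : ℝ)))
      (partialDeriv h p x) 0 := (hh x).hasFDerivAt.hasLineDerivAt _
  have h2 : (fun s : ℝ => h (x + s • EuclideanSpace.single p (1 : ℝ))) = fun _ => h x := by
    funext s
    by_contra hne
    exact hp ⟨_, _, fun q hq => by simp [hq], hne⟩
  rw [h2] at h1
  exact h1.unique (hasDerivAt_const _ _)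

theorem partialDeriv_coalitionCost {f : Costs m} (hf : ∀ i j, ContDiff ℝ 2 (f i j)) (i : Fin N)
    (p : Agent m) (x : Profile m) :
    partialDeriv (coalitionCost f i) p x = ∑ j, partialDeriv (f i j) p x := by
  have : fderiv ℝ (coalitionCost f i) x = ∑ j, fderiv ℝ (f i j) x :=
    fderiv_fun_sum fun j _ => (hf i j).differentiable two_ne_zero x
  simp [partialDeriv, this]

theorem sum_closedNbhd_partialDeriv {f : Costs m} (hf : ∀ i j, ContDiff ℝ 2 (f i j)) (i : Fin N)
    (k : Fin (m i)) (x : Profile m) :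
    ∑ j : closedNbhd f i k, partialDeriv (f i j) ⟨i, k⟩ x = pseudoGradient f x ⟨i, k⟩ := by
  rw [Finset.sum_coe_sort (closedNbhd f i k) fun j => partialDeriv (f i j) ⟨i, k⟩ x]
  change _ = partialDeriv (coalitionCost f i) ⟨i, k⟩ x
  rw [partialDeriv_coalitionCost hf]
  refine Finset.sum_subset (Finset.subset_univ _) fun j _ hj => ?_
  refine partialDeriv_eq_zero ((hf i j).differentiable two_ne_zero) (fun hdep => hj ?_) x
  by_cases hjk : j = k
  · simp [closedNbhd, hjk]
  · simp only [closedNbhd, Finset.mem_filter, Finset.mem_univ, true_and]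
    exact Or.inr ⟨fun h => hjk h.symm, Or.inr hdep⟩

theorem continuous_pseudoGradient {f : Costs m} (hf : ∀ i j, ContDiff ℝ 2 (f i j)) :
    Continuous (pseudoGradient f) := by
  refine (contDiff_euclidean.2 fun p => ?_ : ContDiff ℝ 1 (pseudoGradient f)).continuous
  exact contDiff_partialDeriv (ContDiff.sum fun j _ => hf p.1 j) p

theorem pseudoGradient_eq_zero_of_isNashEquilibrium {f : Costs m}
    (hf : ∀ i j, ContDiff ℝ 2 (f i j)) {xs : Profile m} (hxs : IsNashEquilibrium f xs) :
    pseudoGradient f xs = 0 := by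
  ext p
  change partialDeriv (coalitionCost f p.1) p xs = 0
  have hd : ContDiff ℝ 2 (coalitionCost f p.1) := ContDiff.sum fun j _ => hf p.1 j
  have h1 : HasDerivAt
      (fun s : ℝ => coalitionCost f p.1 (xs + s • EuclideanSpace.single p (1 : ℝ)))
      (partialDeriv (coalitionCost f p.1) p xs) 0 :=
    (hd.differentiable two_ne_zero xs).hasFDerivAt.hasLineDerivAt _
  refine IsLocalMin.hasDerivAt_eq_zero (Eventually.of_forall fun s => ?_) h1
  have := hxs p.1 (xs + s • EuclideanSpace.single p (1 : ℝ)) fun q hq => by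
    have : q ≠ p := fun h => hq (h ▸ rfl)
    simp [this]
  simpa using this

/-- A strictly monotone pseudo-gradient is coercive away from its zero. -/
theorem exists_pos_le_inner_pseudoGradient {f : Costs m} (hf : ∀ i j, ContDiff ℝ 2 (f i j))
    (hmono : IsStrictlyMonotone f) {xs : Profile m} (hxs : pseudoGradient f xs = 0) {r : ℝ}
    (hr : 0 < r) :
    ∃ c, 0 < c ∧ ∀ x, r ≤ ‖x - xs‖ → c ≤ inner ℝ (x - xs) (pseudoGradient f x) := by
  have hpos : ∀ x, x ≠ xs → 0 < inner ℝ (x - xs) (pseudoGradient f x) := fun x hx => by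
    simpa [hxs] using hmono x xs hx
  rcases (Metric.sphere xs r).eq_empty_or_nonempty with he | hne
  · refine ⟨1, one_pos, fun x hx => ?_⟩
    have hx0 : 0 < ‖x - xs‖ := hr.trans_le hx
    have : xs + (r / ‖x - xs‖) • (x - xs) ∈ Metric.sphere xs r := by
      simp [norm_smul, abs_of_pos hr, hx0.ne']
    simp [he] at this
  obtain ⟨x₁, hx₁, hmin⟩ := (isCompact_sphere xs r).exists_isMinOn hne
    (f := fun x => inner ℝ (x - xs) (pseudoGradient f x))
    (((continuous_id.sub continuous_const).inner (continuous_pseudoGradient hf)).continuousOn)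
  have hx₁' : x₁ ≠ xs := fun h => by simp [h, hr.ne] at hx₁
  refine ⟨_, hpos x₁ hx₁', fun x hx => ?_⟩
  have hx0 : 0 < ‖x - xs‖ := hr.trans_le hx
  set θ : ℝ := r / ‖x - xs‖ with hθ
  have hθ0 : 0 < θ := div_pos hr hx0
  have hθ1 : θ ≤ 1 := (div_le_one hx0).2 hx
  have hmem : xs + θ • (x - xs) ∈ Metric.sphere xs r := by
    simp [hθ, norm_smul, abs_of_pos hr, hx0.ne']
  refine (isMinOn_iff.1 hmin _ hmem).trans ?_
  simp only [add_sub_cancel_left, inner_smul_left, RCLike.conj_to_real]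
  have hxne : x ≠ xs := fun h => by simp [h] at hx0
  rcases hθ1.eq_or_lt with h1 | h1
  · rw [h1, one_smul, add_sub_cancel, one_mul]
  · have hne' : x ≠ xs + θ • (x - xs) := fun h => by
      have h2 : (1 - θ) • (x - xs) = 0 := by
        rw [sub_smul, one_smul, sub_eq_zero]
        exact sub_eq_iff_eq_add'.2 h
      rcases smul_eq_zero.1 h2 with h3 | h3
      · linarith
      · exact hxne (sub_eq_zero.1 h3)
    have h2 := hmono _ _ hne'
    have h3 : x - (xs + θ • (x - xs)) = (1 - θ) • (x - xs) := by
      rw [sub_smul, one_smul]; abel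
    rw [h3, inner_smul_left, inner_sub_right] at h2
    simp only [RCLike.conj_to_real] at h2
    have h4 := pos_of_mul_pos_right h2 (by linarith)
    have h5 : 0 < inner ℝ (xs + θ • (x - xs) - xs) (pseudoGradient f (xs + θ • (x - xs))) :=
      hpos _ fun h => by simp [hθ0.ne', sub_eq_zero, hxne] at h
    rw [add_sub_cancel_left, inner_smul_left] at h5
    simp only [RCLike.conj_to_real] at h5
    have h6 := pos_of_mul_pos_right h5 hθ0.le
    nlinarith

/-- A function that is bounded away from zero on the superlevel sets of `V` has a positive monotone
minorant in terms of `V`. -/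
theorem exists_monotone_minorant {X : Type*} {V W : X → ℝ} (hW : ∀ x, 0 ≤ W x)
    (h : ∀ s, 0 < s → ∃ c, 0 < c ∧ ∀ x, s ≤ V x → c ≤ W x) :
    ∃ a : ℝ → ℝ, Monotone a ∧ (∀ s, 0 < s → 0 < a s) ∧ (∀ s, a s ≤ 1) ∧ ∀ x, a (V x) ≤ W x := by
  have hb : ∀ s, BddBelow (insert 1 (W '' {x | s ≤ V x})) := fun s => by
    refine ⟨0, ?_⟩
    rintro _ (rfl | ⟨x, -, rfl⟩)
    · exact zero_le_one
    · exact hW x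
  refine ⟨fun s => sInf (insert 1 (W '' {x | s ≤ V x})), fun s t hst => ?_, fun s hs => ?_,
    fun s => csInf_le (hb s) (mem_insert _ _), fun x =>
    csInf_le (hb _) (mem_insert_of_mem _ ⟨x, le_refl (V x), rfl⟩)⟩
  · exact csInf_le_csInf (hb s) (insert_nonempty _ _)
      (insert_subset_insert (image_mono fun x hx => hst.trans hx))
  · obtain ⟨c, hc, hcW⟩ := h s hs
    refine (lt_min one_pos hc).trans_le (le_csInf (insert_nonempty _ _) ?_)
    rintro _ (rfl | ⟨x, hx, rfl⟩)
    · exact min_le_left _ _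
    · exact (min_le_right _ _).trans (hcW x hx)

end Game

/-! ### Consensus over a connected weighted graph -/

section Consensus

theorem exists_pos_mul_sum_sq_le {ι : Type*} [Fintype ι] {q : EuclideanSpace ℝ ι → ℝ}
    (hq : Continuous q) (hhom : ∀ (c : ℝ) y, q (c • y) = c ^ 2 * q y)
    (hpos : ∀ y, y ≠ 0 → 0 < q y) : ∃ c, 0 < c ∧ ∀ y, c * ‖y‖ ^ 2 ≤ q y := by
  have hscale : ∀ y : EuclideanSpace ℝ ι, y ≠ 0 →
      ‖y‖⁻¹ • y ∈ Metric.sphere (0 : EuclideanSpace ℝ ι) 1 ∧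
        q y = ‖y‖ ^ 2 * q (‖y‖⁻¹ • y) := fun y hy => by
    have hy' := norm_ne_zero_iff.2 hy
    refine ⟨by simp [norm_smul, hy'], ?_⟩
    rw [hhom]; field_simp
  have hq0 : q 0 = 0 := by simpa using hhom 0 0
  rcases (Metric.sphere (0 : EuclideanSpace ℝ ι) 1).eq_empty_or_nonempty with he | hne
  · refine ⟨1, one_pos, fun y => ?_⟩
    by_cases hy : y = 0
    · simp [hy, hq0]
    · have := (hscale y hy).1
      simp [he] at this
  · obtain ⟨y₁, hy₁, hmin⟩ := (isCompact_sphere (0 : EuclideanSpace ℝ ι) 1).exists_isMinOn hne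
      hq.continuousOn
    refine ⟨q y₁, hpos _ fun h => by simp [h] at hy₁, fun y => ?_⟩
    by_cases hy : y = 0
    · simp [hy, hq0]
    · obtain ⟨h1, h2⟩ := hscale y hy
      rw [h2, mul_comm]
      exact mul_le_mul_of_nonneg_left (isMinOn_iff.1 hmin _ h1) (sq_nonneg _)

variable {V : Type} [Fintype V]

open Matrix

theorem IsOrthogonalCompletion.transpose_mul_self [DecidableEq V]
    {R : Matrix V (Fin (Fintype.card V - 1)) ℝ} (hR : IsOrthogonalCompletion R) :
    R.transpose * R = 1 := by
  have h := hR.1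
  rw [transpose_fromCols, fromRows_mul_fromCols, ← fromBlocks_one, fromBlocks_inj] at h
  exact h.2.2.2

theorem IsOrthogonalCompletion.transpose_mulVec_const [DecidableEq V]
    {R : Matrix V (Fin (Fintype.card V - 1)) ℝ} (hR : IsOrthogonalCompletion R) (c : ℝ) :
    R.transpose *ᵥ (fun _ => c) = 0 := by
  have h := hR.1
  rw [transpose_fromCols, fromRows_mul_fromCols, ← fromBlocks_one, fromBlocks_inj] at h
  ext q
  rcases isEmpty_or_nonempty V with hV | hV
  · simp [mulVec, dotProduct]
  have h1 := congrFun (congrFun h.2.2.1 q) ()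
  have hn : (0 : ℝ) < Fintype.card V := Nat.cast_pos.2 Fintype.card_pos
  simp only [mul_apply, transpose_apply, of_apply, Matrix.zero_apply, ← Finset.sum_mul] at h1
  have h2 : ∑ j, R j q = 0 := by
    rcases mul_eq_zero.1 h1 with h | h
    · exact h
    · exact absurd h (by positivity)
  simp [mulVec, dotProduct, ← Finset.sum_mul, h2]

theorem IsOrthogonalCompletion.mulVec_transpose_mulVec [DecidableEq V]
    {R : Matrix V (Fin (Fintype.card V - 1)) ℝ} (hR : IsOrthogonalCompletion R) (g : V → ℝ)
    (j : V) :
    (R *ᵥ (R.transpose *ᵥ g)) j = g j - (∑ l, g l) / Fintype.card V := by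
  have h := hR.2
  rw [transpose_fromCols, fromCols_mul_fromRows] at h
  have h1 := congrFun (congrArg (· *ᵥ g) h) j
  simp only [add_mulVec, one_mulVec, Pi.add_apply, ← mulVec_mulVec] at h1
  rw [eq_sub_iff_add_eq, ← h1, add_comm, mulVec_mulVec]
  congr 1
  have : ∀ l : V, (1 / √(Fintype.card V : ℝ)) * (1 / √(Fintype.card V : ℝ)) * g l
      = g l / Fintype.card V := fun l => by
    rw [div_mul_div_comm, Real.mul_self_sqrt (Nat.cast_nonneg _)]; ring
  simp [mulVec, dotProduct, Finset.sum_div, ← this, Finset.mul_sum, mul_assoc]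

theorem WeightedGraph.IsUndirected.sum_laplacian_eq_zero {G : WeightedGraph V}
    (hG : G.IsUndirected) (g : V → ℝ) : ∑ j, ∑ l, G.weight j l * (g j - g l) = 0 := by
  have h : ∑ j, ∑ l, G.weight j l * (g j - g l) = -∑ j, ∑ l, G.weight j l * (g j - g l) := by
    conv_lhs => rw [Finset.sum_comm]
    simp only [← Finset.sum_neg_distrib]
    refine Finset.sum_congr rfl fun j _ => Finset.sum_congr rfl fun l _ => ?_
    rw [hG l j]; ring
  linarith

theorem WeightedGraph.IsUndirected.sum_mul_laplacian {G : WeightedGraph V}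
    (hG : G.IsUndirected) (g : V → ℝ) :
    ∑ j, g j * ∑ l, G.weight j l * (g j - g l) =
      (∑ j, ∑ l, G.weight j l * (g j - g l) ^ 2) / 2 := by
  have h : ∑ j, ∑ l, G.weight j l * (g j * (g j - g l)) =
      ∑ j, ∑ l, G.weight j l * (g l * (g l - g j)) := by
    rw [Finset.sum_comm]
    refine Finset.sum_congr rfl fun j _ => Finset.sum_congr rfl fun l _ => ?_
    rw [hG l j]
  have h2 : ∑ j, ∑ l, G.weight j l * (g j - g l) ^ 2 =
      ∑ j, ∑ l, G.weight j l * (g j * (g j - g l)) +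
        ∑ j, ∑ l, G.weight j l * (g l * (g l - g j)) := by
    simp only [← Finset.sum_add_distrib]
    refine Finset.sum_congr rfl fun j _ => Finset.sum_congr rfl fun l _ => ?_
    ring
  rw [h2, ← h, add_self_div_two]
  refine Finset.sum_congr rfl fun j _ => ?_
  rw [Finset.mul_sum]
  exact Finset.sum_congr rfl fun l _ => by ring

theorem WeightedGraph.IsConnected.eq_of_sum_sq_eq_zero {G : WeightedGraph V}
    (hG : G.IsConnected) {g : V → ℝ} (h : ∑ j, ∑ l, G.weight j l * (g j - g l) ^ 2 = 0) (u v : V) :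
    g u = g v := by
  have hnn : ∀ j l, 0 ≤ G.weight j l * (g j - g l) ^ 2 := fun j l =>
    mul_nonneg (G.nonneg j l) (sq_nonneg _)
  have h0 : ∀ j l, G.weight j l * (g j - g l) ^ 2 = 0 := fun j l => by
    have h1 := (Finset.sum_eq_zero_iff_of_nonneg fun j _ =>
      Finset.sum_nonneg fun l _ => hnn j l).1 h j (Finset.mem_univ j)
    exact (Finset.sum_eq_zero_iff_of_nonneg fun l _ => hnn j l).1 h1 l (Finset.mem_univ l)
  induction hG u v with
  | refl => rfl
  | tail _ hbc ih =>
    rw [ih]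
    rcases mul_eq_zero.1 (h0 _ _) with h1 | h1
    · exact absurd h1 hbc.ne'
    · exact (sub_eq_zero.1 (pow_eq_zero_iff two_ne_zero |>.1 h1)).symm

/-- The spectral gap of the Laplacian of a connected graph. -/
theorem WeightedGraph.exists_spectral_gap [DecidableEq V] {G : WeightedGraph V}
    (hGu : G.IsUndirected)
    (hGc : G.IsConnected) {R : Matrix V (Fin (Fintype.card V - 1)) ℝ}
    (hR : IsOrthogonalCompletion R) :
    ∃ c, 0 < c ∧ ∀ g : V → ℝ, c * ∑ q, (R.transpose *ᵥ g) q ^ 2 ≤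
      ∑ j, g j * ∑ l, G.weight j l * (g j - g l) := by
  let Q : (V → ℝ) → ℝ := fun g => (∑ j, ∑ l, G.weight j l * (g j - g l) ^ 2) / 2
  have hQ0 : ∀ g, 0 ≤ Q g := fun g => div_nonneg (Finset.sum_nonneg fun j _ =>
    Finset.sum_nonneg fun l _ => mul_nonneg (G.nonneg j l) (sq_nonneg _)) zero_le_two
  obtain ⟨c, hc, hcQ⟩ := exists_pos_mul_sum_sq_le
    (q := fun y : EuclideanSpace ℝ (Fin (Fintype.card V - 1)) => Q (R *ᵥ y.ofLp))
    (by
      simp only [Q, mulVec, dotProduct]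
      fun_prop)
    (fun t y => by
      simp only [Q, WithLp.ofLp_smul, mulVec_smul, Pi.smul_apply, smul_eq_mul, ← mul_sub,
        mul_pow]
      simp only [mul_left_comm _ (t ^ 2), ← Finset.mul_sum, mul_div_assoc])
    (fun y hy => by
      refine (hQ0 _).lt_of_ne' fun h => hy ?_
      have hconst := hGc.eq_of_sum_sq_eq_zero ((div_eq_zero_iff.1 h).resolve_right two_ne_zero)
      rcases isEmpty_or_nonempty V with hV | ⟨⟨v⟩⟩
      · have h1 := hR.transpose_mul_self
        ext q
        have h2 := congrFun (congrFun h1 q) q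
        simp [mul_apply] at h2
      · have h1 : R *ᵥ y.ofLp = fun _ => (R *ᵥ y.ofLp) v := funext fun u => hconst u v
        have h2 := congrArg (R.transpose *ᵥ ·) h1
        simp only [mulVec_mulVec, hR.transpose_mul_self, one_mulVec,
          hR.transpose_mulVec_const] at h2
        exact (WithLp.ofLp_eq_zero 2).1 h2)
  refine ⟨c, hc, fun g => ?_⟩
  have h1 := hcQ (WithLp.toLp 2 (R.transpose *ᵥ g))
  rw [EuclideanSpace.real_norm_sq_eq] at h1
  refine h1.trans (le_of_eq ?_)
  rw [hGu.sum_mul_laplacian]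
  simp only [Q, hR.mulVec_transpose_mulVec, sub_sub_sub_cancel_right]

end Consensus

/-! ### The seeking dynamics as a two-time-scale system -/

section Dynamics

open Matrix

variable {N : ℕ} {m : Fin N → ℕ}

/-- The joint state `(x, w)` of the seeking dynamics. -/
abbrev State (f : Costs m) : Type := Profile m × Aux f

/-- The slow part of the seeking dynamics: the actions follow the estimates. -/
noncomputable def slowField (f : Costs m) (d : (i : Fin N) → Fin (m i) → ℝ) (z : State f) :
    State f :=
  (WithLp.toLp 2 fun p => -(d p.1 p.2) *
    estimate f z.1 z.2 p.1 p.2 ⟨p.2, self_mem_closedNbhd f p.1 p.2⟩, 0)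

/-- The fast part of the seeking dynamics: the estimates reach consensus. -/
noncomputable def fastField (f : Costs m) (C : (i : Fin N) → WeightedGraph (Fin (m i)))
    (z : State f) : State f :=
  (0, fun i k j => -∑ l : closedNbhd f i k, (C i).weight j l *
    (estimate f z.1 z.2 i k j - estimate f z.1 z.2 i k l))

/-- The states in which the auxiliary variables have zero sum. -/
def balancedStates (f : Costs m) : Set (State f) := {z | ∀ i k, ∑ j, z.2 i k j = 0}

/-- The squared norm of the consensus disagreement. -/
noncomputable def disagreementEnergy (f : Costs m) (R : Frames f) (z : State f) : ℝ :=
  ∑ q : (p : Agent m) × Fin (Fintype.card (closedNbhd f p.1 p.2) - 1),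
    disagreement f R z.1 z.2 q.1.1 q.1.2 q.2 ^ 2

/-- The weight of agent `p` in the Lyapunov function of the slow system. -/
noncomputable def trackingWeight (f : Costs m) (d : (i : Fin N) → Fin (m i) → ℝ) (p : Agent m) :
    ℝ :=
  Fintype.card (closedNbhd f p.1 p.2) / (2 * d p.1 p.2)

/-- The Lyapunov function of the slow system. -/
noncomputable def trackingEnergy (f : Costs m) (d : (i : Fin N) → Fin (m i) → ℝ) (xs : Profile m)
    (z : State f) : ℝ :=
  ∑ p, trackingWeight f d p * (z.1 p - xs p) ^ 2

theorem card_closedNbhd_pos (f : Costs m) (i : Fin N) (k : Fin (m i)) :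
    (0 : ℝ) < Fintype.card (closedNbhd f i k) :=
  Nat.cast_pos.2 (Fintype.card_pos_iff.2 ⟨⟨k, self_mem_closedNbhd f i k⟩⟩)

theorem trackingWeight_pos (f : Costs m) {d : (i : Fin N) → Fin (m i) → ℝ}
    (hd : ∀ i j, 0 < d i j) (p : Agent m) : 0 < trackingWeight f d p :=
  div_pos (card_closedNbhd_pos f p.1 p.2) (mul_pos two_pos (hd p.1 p.2))

theorem hasDerivWithinAt_euclidean {ι : Type*} [Fintype ι] {x : ℝ → EuclideanSpace ℝ ι}
    {x' : EuclideanSpace ℝ ι} {s : Set ℝ} {t : ℝ} :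
    HasDerivWithinAt x x' s t ↔ ∀ p, HasDerivWithinAt (fun r => x r p) (x' p) s t := by
  simp only [hasDerivWithinAt_iff_hasFDerivWithinAt]
  rw [hasFDerivWithinAt_euclidean]
  refine forall_congr' fun p => ?_
  have : (PiLp.proj 2 (fun _ : ι => ℝ) p).comp (ContinuousLinearMap.toSpanSingleton ℝ x') =
      ContinuousLinearMap.toSpanSingleton ℝ (x' p) := by
    ext; simp
  rw [this]

theorem hasDerivWithinAt_fst {E F : Type*} [NormedAddCommGroup E] [NormedSpace ℝ E]
    [NormedAddCommGroup F] [NormedSpace ℝ F] {z : ℝ → E × F} {z' : E × F} {s : Set ℝ} {t : ℝ}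
    (h : HasDerivWithinAt z z' s t) : HasDerivWithinAt (fun r => (z r).1) z'.1 s t :=
  (ContinuousLinearMap.fst ℝ E F).hasFDerivAt.comp_hasDerivWithinAt t h

theorem hasDerivWithinAt_snd {E F : Type*} [NormedAddCommGroup E] [NormedSpace ℝ E]
    [NormedAddCommGroup F] [NormedSpace ℝ F] {z : ℝ → E × F} {z' : E × F} {s : Set ℝ} {t : ℝ}
    (h : HasDerivWithinAt z z' s t) : HasDerivWithinAt (fun r => (z r).2) z'.2 s t :=
  (ContinuousLinearMap.snd ℝ E F).hasFDerivAt.comp_hasDerivWithinAt t h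

theorem isTrajectory_iff {f : Costs m} {C : (i : Fin N) → WeightedGraph (Fin (m i))}
    {d : (i : Fin N) → Fin (m i) → ℝ} {δ : ℝ} {x₀ : Profile m} {x : ℝ → Profile m}
    {w : ℝ → Aux f} :
    IsTrajectory f C d δ x₀ x w ↔ (x 0, w 0) = (x₀, 0) ∧ ∀ t, 0 ≤ t →
      HasDerivWithinAt (fun s => (x s, w s))
        (δ • slowField f d (x t, w t) + fastField f C (x t, w t)) (Ici 0) t := by
  have key : ∀ t, HasDerivWithinAt (fun s => (x s, w s))
        (δ • slowField f d (x t, w t) + fastField f C (x t, w t)) (Ici 0) t ↔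
      (∀ (i : Fin N) (j : Fin (m i)), HasDerivWithinAt (fun s => x s ⟨i, j⟩)
        (-(δ * d i j) * estimate f (x t) (w t) i j ⟨j, self_mem_closedNbhd f i j⟩) (Ici 0) t) ∧
      ∀ (i : Fin N) (k : Fin (m i)) (j : closedNbhd f i k), HasDerivWithinAt (fun s => w s i k j)
        (-∑ l : closedNbhd f i k, (C i).weight j l *
          (estimate f (x t) (w t) i k j - estimate f (x t) (w t) i k l)) (Ici 0) t := by
    intro t
    have h1 : HasDerivWithinAt (fun s => (x s, w s))
        (δ • slowField f d (x t, w t) + fastField f C (x t, w t)) (Ici 0) t ↔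
        HasDerivWithinAt x (δ • (slowField f d (x t, w t)).1) (Ici 0) t ∧
        HasDerivWithinAt w ((fastField f C (x t, w t)).2) (Ici 0) t := by
      constructor
      · intro h
        refine ⟨?_, ?_⟩
        · simpa [fastField] using hasDerivWithinAt_fst h
        · simpa [slowField] using hasDerivWithinAt_snd h
      · rintro ⟨h1, h2⟩
        simpa [slowField, fastField] using h1.prodMk h2
    rw [h1, hasDerivWithinAt_euclidean]
    simp only [hasDerivWithinAt_pi]
    refine and_congr ⟨fun h i j => ?_, fun h p => ?_⟩ Iff.rfl
    · convert h ⟨i, j⟩ using 1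
      simp [slowField, mul_assoc]
    · convert h p.1 p.2 using 1
      simp [slowField, mul_assoc]
  constructor
  · intro h
    exact ⟨by rw [h.x_init, h.w_init], fun t ht => (key t).2 ⟨h.x_deriv t ht, h.w_deriv t ht⟩⟩
  · rintro ⟨h0, h⟩
    exact ⟨congrArg Prod.fst h0, congrArg Prod.snd h0, fun t ht => ((key t).1 (h t ht)).1,
      fun t ht => ((key t).1 (h t ht)).2⟩

theorem contDiff_estimate {f : Costs m} (hf : ∀ i j, ContDiff ℝ 2 (f i j)) (i : Fin N)
    (k : Fin (m i)) (j : closedNbhd f i k) :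
    ContDiff ℝ 1 fun z : State f => estimate f z.1 z.2 i k j := by
  have h1 : ContDiff ℝ 1 fun z : State f => z.2 i k j :=
    contDiff_pi.1 (contDiff_pi.1 (contDiff_pi.1 contDiff_snd i) k) j
  exact h1.add ((contDiff_partialDeriv (hf i j) ⟨i, k⟩).comp contDiff_fst)

theorem contDiff_slowField {f : Costs m} (hf : ∀ i j, ContDiff ℝ 2 (f i j))
    (d : (i : Fin N) → Fin (m i) → ℝ) : ContDiff ℝ 1 (slowField f d) := by
  refine ContDiff.prodMk (contDiff_euclidean.2 fun p => ?_) contDiff_const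
  exact contDiff_const.mul (contDiff_estimate hf _ _ _)

theorem contDiff_fastField {f : Costs m} (hf : ∀ i j, ContDiff ℝ 2 (f i j))
    (C : (i : Fin N) → WeightedGraph (Fin (m i))) : ContDiff ℝ 1 (fastField f C) := by
  refine ContDiff.prodMk contDiff_const (contDiff_pi.2 fun i => contDiff_pi.2 fun k =>
    contDiff_pi.2 fun j => ?_)
  exact (ContDiff.sum fun l _ => contDiff_const.mul
    ((contDiff_estimate hf _ _ _).sub (contDiff_estimate hf _ _ _))).neg

theorem contDiff_disagreementEnergy {f : Costs m} (hf : ∀ i j, ContDiff ℝ 2 (f i j))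
    (R : Frames f) : ContDiff ℝ 1 (disagreementEnergy f R) := by
  refine ContDiff.sum fun q _ => ContDiff.pow ?_ 2
  simp only [disagreement, mulVec, dotProduct]
  exact ContDiff.sum fun j _ => contDiff_const.mul (contDiff_estimate hf _ _ j)

theorem contDiff_trackingEnergy (f : Costs m) (d : (i : Fin N) → Fin (m i) → ℝ) (xs : Profile m) :
    ContDiff ℝ 1 (trackingEnergy f d xs) := by
  refine ContDiff.sum fun p _ => contDiff_const.mul (ContDiff.pow (ContDiff.sub ?_ contDiff_const) 2)
  exact contDiff_euclidean.1 contDiff_fst p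

theorem disagreementEnergy_nonneg (f : Costs m) (R : Frames f) (z : State f) :
    0 ≤ disagreementEnergy f R z :=
  Finset.sum_nonneg fun _ _ => sq_nonneg _

theorem trackingEnergy_nonneg (f : Costs m) {d : (i : Fin N) → Fin (m i) → ℝ}
    (hd : ∀ i j, 0 < d i j) (xs : Profile m) (z : State f) : 0 ≤ trackingEnergy f d xs z :=
  Finset.sum_nonneg fun p _ => mul_nonneg (trackingWeight_pos f hd p).le (sq_nonneg _)

theorem abs_disagreement_le (f : Costs m) (R : Frames f) (z : State f) (i : Fin N) (k : Fin (m i))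
    (q : Fin (Fintype.card (closedNbhd f i k) - 1)) :
    |disagreement f R z.1 z.2 i k q| ≤ √(disagreementEnergy f R z) := by
  let F : (p : Agent m) × Fin (Fintype.card (closedNbhd f p.1 p.2) - 1) → ℝ :=
    fun q => disagreement f R z.1 z.2 q.1.1 q.1.2 q.2 ^ 2
  have h : F ⟨⟨i, k⟩, q⟩ ≤ ∑ q', F q' :=
    Finset.single_le_sum (f := F) (fun _ _ => sq_nonneg _) (Finset.mem_univ _)
  exact Real.abs_le_sqrt h

theorem norm_errorState_sq (f : Costs m) (R : Frames f) (xs : Profile m) (z : State f) :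
    ‖errorState f R xs z.1 z.2‖ ^ 2 = disagreementEnergy f R z + ‖z.1 - xs‖ ^ 2 := by
  rw [EuclideanSpace.real_norm_sq_eq, EuclideanSpace.real_norm_sq_eq, Fintype.sum_sum_type]
  simp [errorState, disagreementEnergy]

theorem exists_trackingEnergy_bounds (f : Costs m) {d : (i : Fin N) → Fin (m i) → ℝ}
    (hd : ∀ i j, 0 < d i j) (xs : Profile m) :
    ∃ c₁ c₂ : ℝ, 0 < c₁ ∧ 0 < c₂ ∧ ∀ z : State f, c₁ * ‖z.1 - xs‖ ^ 2 ≤ trackingEnergy f d xs z ∧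
      trackingEnergy f d xs z ≤ c₂ * ‖z.1 - xs‖ ^ 2 := by
  have hpos := trackingWeight_pos f hd
  obtain ⟨c₁, hc₁, hle⟩ : ∃ c₁ : ℝ, 0 < c₁ ∧ ∀ p, c₁ ≤ trackingWeight f d p := by
    rcases isEmpty_or_nonempty (Agent m) with h | h
    · exact ⟨1, one_pos, fun p => h.elim p⟩
    · obtain ⟨p, hp⟩ := Finite.exists_min (trackingWeight f d)
      exact ⟨_, hpos p, hp⟩
  refine ⟨c₁, ∑ p, trackingWeight f d p + 1, hc₁,
    add_pos_of_nonneg_of_pos (Finset.sum_nonneg fun p _ => (hpos p).le) one_pos, fun z => ?_⟩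
  rw [EuclideanSpace.real_norm_sq_eq, Finset.mul_sum, Finset.mul_sum]
  refine ⟨Finset.sum_le_sum fun p _ => mul_le_mul_of_nonneg_right (hle p) (sq_nonneg _),
    Finset.sum_le_sum fun p _ => mul_le_mul_of_nonneg_right ?_ (sq_nonneg _)⟩
  have := Finset.single_le_sum (fun p _ => (hpos p).le) (Finset.mem_univ p)
  linarith

theorem sum_fastField {f : Costs m} {C : (i : Fin N) → WeightedGraph (Fin (m i))}
    (hCu : ∀ i k, (interferenceToGraph f C i k).IsUndirected) (z : State f) (i : Fin N)
    (k : Fin (m i)) : ∑ j, (fastField f C z).2 i k j = 0 := by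
  refine (Finset.sum_neg_distrib _).trans (neg_eq_zero.2 ?_)
  exact (hCu i k).sum_laplacian_eq_zero (estimate f z.1 z.2 i k)

theorem balancedStates_invariant {f : Costs m} {C : (i : Fin N) → WeightedGraph (Fin (m i))}
    (hCu : ∀ i k, (interferenceToGraph f C i k).IsUndirected) (d : (i : Fin N) → Fin (m i) → ℝ)
    (δ : ℝ) (z : ℝ → State f) (T : ℝ) (hT : 0 ≤ T) (h0 : z 0 ∈ balancedStates f)
    (hz : ∀ t ∈ Icc 0 T, HasDerivWithinAt z
      (δ • slowField f d (z t) + fastField f C (z t)) (Ici 0) t) : z T ∈ balancedStates f := by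
  intro i k
  have hder : ∀ t ∈ Icc 0 T, HasDerivWithinAt (fun t => ∑ j, (z t).2 i k j) 0 (Ici 0) t := by
    intro t ht
    have h1 : HasDerivWithinAt (fun t => (z t).2) (fastField f C (z t)).2 (Ici 0) t := by
      simpa [slowField] using hasDerivWithinAt_snd (hz t ht)
    have h2 := HasDerivWithinAt.fun_sum (u := Finset.univ) fun j _ => hasDerivWithinAt_pi.1
      (hasDerivWithinAt_pi.1 (hasDerivWithinAt_pi.1 h1 i) k) j
    rwa [sum_fastField hCu] at h2
  have h1 := le_of_hasDerivWithinAt_nonpos le_rfl hT hder fun _ _ => le_rfl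
  have h2 : -∑ j, (z T).2 i k j ≤ -∑ j, (z 0).2 i k j :=
    le_of_hasDerivWithinAt_nonpos (y := fun t => -∑ j, (z t).2 i k j) le_rfl hT
      (fun t ht => (hder t ht).neg) fun _ _ => neg_zero.le
  have h3 := h0 i k
  linarith

theorem sum_estimate {f : Costs m} (hf : ∀ i j, ContDiff ℝ 2 (f i j)) {z : State f}
    (hz : z ∈ balancedStates f) (i : Fin N) (k : Fin (m i)) :
    ∑ j, estimate f z.1 z.2 i k j = pseudoGradient f z.1 ⟨i, k⟩ := by
  simp only [estimate, Finset.sum_add_distrib, hz i k, zero_add]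
  exact sum_closedNbhd_partialDeriv hf i k z.1

/-- On balanced states an estimate is the average partial derivative plus a disagreement term. -/
theorem estimate_eq {f : Costs m} (hf : ∀ i j, ContDiff ℝ 2 (f i j)) {R : Frames f}
    (hR : ∀ i k, IsOrthogonalCompletion (R i k)) {z : State f} (hz : z ∈ balancedStates f)
    (i : Fin N) (k : Fin (m i)) (j : closedNbhd f i k) :
    estimate f z.1 z.2 i k j = (R i k *ᵥ disagreement f R z.1 z.2 i k) j +
      pseudoGradient f z.1 ⟨i, k⟩ / Fintype.card (closedNbhd f i k) := by
  rw [disagreement, (hR i k).mulVec_transpose_mulVec, sum_estimate hf hz]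
  ring

theorem hasDerivAt_sq_affine (a b : ℝ) :
    HasDerivAt (fun s : ℝ => (a + s * b) ^ 2) (2 * a * b) 0 := by
  simpa using (((hasDerivAt_id' (0 : ℝ)).mul_const b).const_add a).fun_pow 2

theorem fderiv_disagreementEnergy_fastField_le {f : Costs m} (hf : ∀ i j, ContDiff ℝ 2 (f i j))
    {C : (i : Fin N) → WeightedGraph (Fin (m i))}
    (hCu : ∀ i k, (interferenceToGraph f C i k).IsUndirected)
    (hCc : ∀ i k, (interferenceToGraph f C i k).IsConnected)
    {R : Frames f} (hR : ∀ i k, IsOrthogonalCompletion (R i k)) :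
    ∃ μ, 0 < μ ∧ ∀ z, fderiv ℝ (disagreementEnergy f R) z (fastField f C z) ≤
      -μ * disagreementEnergy f R z := by
  choose γ hγ hgap using fun p : Agent m =>
    WeightedGraph.exists_spectral_gap (hCu p.1 p.2) (hCc p.1 p.2) (hR p.1 p.2)
  obtain ⟨c, hc, hle⟩ : ∃ c : ℝ, 0 < c ∧ ∀ p, c ≤ γ p := by
    rcases isEmpty_or_nonempty (Agent m) with h | h
    · exact ⟨1, one_pos, fun p => h.elim p⟩
    · obtain ⟨p, hp⟩ := Finite.exists_min γ
      exact ⟨_, hγ p, hp⟩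
  refine ⟨2 * c, by positivity, fun z => ?_⟩
  set ω := (fastField f C z).2 with hω
  have hline : HasDerivAt (fun s : ℝ => disagreementEnergy f R (z + s • fastField f C z))
      (fderiv ℝ (disagreementEnergy f R) z (fastField f C z)) 0 :=
    ((contDiff_disagreementEnergy hf R).differentiable one_ne_zero z).hasFDerivAt.hasLineDerivAt _
  have hlin : ∀ (s : ℝ) i k q,
      disagreement f R (z + s • fastField f C z).1 (z + s • fastField f C z).2 i k q =
        disagreement f R z.1 z.2 i k q + s * ((R i k).transpose *ᵥ ω i k) q := by
    intro s i k q
    have : estimate f (z + s • fastField f C z).1 (z + s • fastField f C z).2 i k =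
        estimate f z.1 z.2 i k + s • ω i k := by
      funext j
      simp [estimate, hω, fastField]
      ring
    rw [disagreement, this, mulVec_add, mulVec_smul]
    rfl
  have hline' : HasDerivAt (fun s : ℝ => disagreementEnergy f R (z + s • fastField f C z))
      (∑ q : (p : Agent m) × Fin (Fintype.card (closedNbhd f p.1 p.2) - 1),
        2 * disagreement f R z.1 z.2 q.1.1 q.1.2 q.2 *
          ((R q.1.1 q.1.2).transpose *ᵥ ω q.1.1 q.1.2) q.2) 0 := by
    simp only [disagreementEnergy, hlin]
    exact HasDerivAt.fun_sum fun q _ => hasDerivAt_sq_affine _ _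
  have hsigma : ∀ G : (p : Agent m) × Fin (Fintype.card (closedNbhd f p.1 p.2) - 1) → ℝ,
      ∑ q, G q = ∑ p : Agent m, ∑ q, G ⟨p, q⟩ := fun G => Fintype.sum_sigma G
  rw [hline.unique hline', disagreementEnergy, hsigma, hsigma, Finset.mul_sum]
  refine Finset.sum_le_sum fun p _ => ?_
  have h1 : ∑ q, disagreement f R z.1 z.2 p.1 p.2 q * ((R p.1 p.2).transpose *ᵥ ω p.1 p.2) q =
      ∑ j, estimate f z.1 z.2 p.1 p.2 j * ω p.1 p.2 j := by
    have h2 : ∑ j, ω p.1 p.2 j = 0 := sum_fastField hCu z p.1 p.2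
    change disagreement f R z.1 z.2 p.1 p.2 ⬝ᵥ ((R p.1 p.2).transpose *ᵥ ω p.1 p.2) = _
    rw [dotProduct_mulVec, vecMul_transpose]
    simp only [dotProduct, disagreement, (hR p.1 p.2).mulVec_transpose_mulVec, sub_mul,
      Finset.sum_sub_distrib, ← Finset.mul_sum, h2, mul_zero, sub_zero]
  have h3 : ∑ j, estimate f z.1 z.2 p.1 p.2 j * ω p.1 p.2 j =
      -∑ j, estimate f z.1 z.2 p.1 p.2 j * ∑ l, (interferenceToGraph f C p.1 p.2).weight j l *
        (estimate f z.1 z.2 p.1 p.2 j - estimate f z.1 z.2 p.1 p.2 l) := by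
    rw [← Finset.sum_neg_distrib]
    exact Finset.sum_congr rfl fun j _ => mul_neg _ _
  have h4 := hgap p (estimate f z.1 z.2 p.1 p.2)
  have h5 : 0 ≤ ∑ q, disagreement f R z.1 z.2 p.1 p.2 q ^ 2 :=
    Finset.sum_nonneg fun _ _ => sq_nonneg _
  have h6 := mul_le_mul_of_nonneg_right (hle p) h5
  simp only [mul_assoc, ← Finset.mul_sum]
  rw [h1, h3]
  simp only [disagreement] at h6 ⊢
  linarith

theorem fderiv_trackingEnergy (f : Costs m) (d : (i : Fin N) → Fin (m i) → ℝ) (xs : Profile m)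
    (z y : State f) : fderiv ℝ (trackingEnergy f d xs) z y =
      ∑ p, trackingWeight f d p * (2 * (z.1 p - xs p) * y.1 p) := by
  have hline : HasDerivAt (fun s : ℝ => trackingEnergy f d xs (z + s • y))
      (fderiv ℝ (trackingEnergy f d xs) z y) 0 :=
    ((contDiff_trackingEnergy f d xs).differentiable one_ne_zero z).hasFDerivAt.hasLineDerivAt _
  refine hline.unique (HasDerivAt.fun_sum fun p _ => HasDerivAt.const_mul _ ?_)
  have h : ∀ s : ℝ, (z + s • y).1 p - xs p = z.1 p - xs p + s * y.1 p := fun s => by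
    simp only [Prod.fst_add, Prod.smul_fst, PiLp.add_apply, PiLp.smul_apply, smul_eq_mul]
    ring
  simp only [h]
  exact hasDerivAt_sq_affine _ _

theorem fderiv_trackingEnergy_slowField_le {f : Costs m} (hf : ∀ i j, ContDiff ℝ 2 (f i j))
    {d : (i : Fin N) → Fin (m i) → ℝ} (hd : ∀ i j, 0 < d i j) (xs : Profile m)
    {R : Frames f} (hR : ∀ i k, IsOrthogonalCompletion (R i k)) (M : ℝ) :
    ∃ c, 0 ≤ c ∧ ∀ z ∈ balancedStates f, trackingEnergy f d xs z ≤ M →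
      fderiv ℝ (trackingEnergy f d xs) z (slowField f d z) ≤
        -inner ℝ (z.1 - xs) (pseudoGradient f z.1) + c * √(disagreementEnergy f R z) := by
  obtain ⟨c₁, c₂, hc₁, hc₂, hbounds⟩ := exists_trackingEnergy_bounds f hd xs
  let r : (p : Agent m) → ℝ := fun p =>
    ∑ q, |R p.1 p.2 ⟨p.2, self_mem_closedNbhd f p.1 p.2⟩ q|
  have hr : ∀ p, 0 ≤ r p := fun p => Finset.sum_nonneg fun _ _ => abs_nonneg _
  refine ⟨∑ p : Agent m, Fintype.card (closedNbhd f p.1 p.2) * (√(M / c₁) * r p),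
    Finset.sum_nonneg fun p _ => by have := hr p; positivity, fun z hz hM => ?_⟩
  have he : ∀ p, |z.1 p - xs p| ≤ √(M / c₁) := fun p => by
    refine Real.abs_le_sqrt ?_
    rw [le_div_iff₀ hc₁, mul_comm]
    refine le_trans (mul_le_mul_of_nonneg_left ?_ hc₁.le) ((hbounds z).1.trans hM)
    rw [EuclideanSpace.real_norm_sq_eq]
    let F : Agent m → ℝ := fun p => (z.1 - xs) p ^ 2
    have h : F p ≤ ∑ p', F p' :=
      Finset.single_le_sum (f := F) (fun _ _ => sq_nonneg _) (Finset.mem_univ _)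
    exact h
  have hRD : ∀ p : Agent m, |(R p.1 p.2 *ᵥ disagreement f R z.1 z.2 p.1 p.2)
      ⟨p.2, self_mem_closedNbhd f p.1 p.2⟩| ≤ r p * √(disagreementEnergy f R z) := fun p => by
    refine (Finset.abs_sum_le_sum_abs (fun q => R p.1 p.2 ⟨p.2, self_mem_closedNbhd f p.1 p.2⟩ q *
      disagreement f R z.1 z.2 p.1 p.2 q) Finset.univ).trans ?_
    rw [Finset.sum_mul]
    refine Finset.sum_le_sum fun q _ => ?_
    rw [abs_mul]
    exact mul_le_mul_of_nonneg_left (abs_disagreement_le f R z p.1 p.2 q) (abs_nonneg _)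
  rw [fderiv_trackingEnergy, PiLp.inner_apply, ← Finset.sum_neg_distrib, Finset.sum_mul,
    ← Finset.sum_add_distrib]
  refine Finset.sum_le_sum fun p _ => ?_
  have hn := card_closedNbhd_pos f p.1 p.2
  have hdp := hd p.1 p.2
  have h1 : trackingWeight f d p * (2 * (z.1 p - xs p) * (slowField f d z).1 p) =
      -((z.1 p - xs p) * pseudoGradient f z.1 p) - Fintype.card (closedNbhd f p.1 p.2) *
        ((z.1 p - xs p) * (R p.1 p.2 *ᵥ disagreement f R z.1 z.2 p.1 p.2)
          ⟨p.2, self_mem_closedNbhd f p.1 p.2⟩) := by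
    simp only [slowField, estimate_eq hf hR hz, trackingWeight]
    field_simp
    ring
  rw [h1]
  have h2 : -((z.1 p - xs p) * (R p.1 p.2 *ᵥ disagreement f R z.1 z.2 p.1 p.2)
      ⟨p.2, self_mem_closedNbhd f p.1 p.2⟩) ≤
      √(M / c₁) * (r p * √(disagreementEnergy f R z)) := by
    refine (neg_le_abs _).trans ?_
    rw [abs_mul]
    exact mul_le_mul (he p) (hRD p) (abs_nonneg _) (Real.sqrt_nonneg _)
  have h3 := mul_le_mul_of_nonneg_left h2 hn.le
  have h4 : inner ℝ ((z.1 - xs) p) (pseudoGradient f z.1 p) =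
      (z.1 p - xs p) * pseudoGradient f z.1 p := by
    simp [mul_comm]
  rw [h4]
  linarith

theorem exists_norm_le_of_energies_le {f : Costs m} (hf : ∀ i j, ContDiff ℝ 2 (f i j))
    {d : (i : Fin N) → Fin (m i) → ℝ} (hd : ∀ i j, 0 < d i j) (xs : Profile m)
    {R : Frames f} (hR : ∀ i k, IsOrthogonalCompletion (R i k)) (M : ℝ) :
    ∃ ρ, ∀ z ∈ balancedStates f, trackingEnergy f d xs z ≤ M → disagreementEnergy f R z ≤ M →
      ‖z‖ ≤ ρ := by
  obtain ⟨c₁, c₂, hc₁, hc₂, hbounds⟩ := exists_trackingEnergy_bounds f hd xs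
  let Y := (i : Fin N) → (k : Fin (m i)) → Fin (Fintype.card (closedNbhd f i k) - 1) → ℝ
  let Φ : Profile m × Y → State f := fun u => (u.1, fun i k j => (R i k *ᵥ u.2 i k) j +
    pseudoGradient f u.1 ⟨i, k⟩ / Fintype.card (closedNbhd f i k) -
      partialDeriv (f i j) ⟨i, k⟩ u.1)
  have hΦ : Continuous Φ := by
    refine continuous_fst.prodMk (continuous_pi fun i => continuous_pi fun k =>
      continuous_pi fun j => ?_)
    have h1 : Continuous fun u : Profile m × Y => pseudoGradient f u.1 ⟨i, k⟩ :=
      (EuclideanSpace.proj (𝕜 := ℝ) (⟨i, k⟩ : Agent m)).continuous.comp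
        ((continuous_pseudoGradient hf).comp continuous_fst)
    have h2 : Continuous fun u : Profile m × Y => partialDeriv (f i j) ⟨i, k⟩ u.1 :=
      (contDiff_partialDeriv (hf i j) _).continuous.comp continuous_fst
    have h3 : Continuous fun u : Profile m × Y => (R i k *ᵥ u.2 i k) j := by
      simp only [mulVec, dotProduct]
      fun_prop
    exact (h3.add (h1.div_const _)).sub h2
  obtain ⟨ρ, hρ⟩ := ((isCompact_closedBall xs √(M / c₁)).prod
    (isCompact_closedBall (0 : Y) √M)).exists_bound_of_continuousOn hΦ.continuousOn
  refine ⟨ρ, fun z hz hV hU => ?_⟩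
  have hzΦ : Φ (z.1, fun i k => disagreement f R z.1 z.2 i k) = z := by
    refine Prod.ext rfl ?_
    funext i k j
    have := estimate_eq hf hR hz i k j
    simp only [estimate] at this
    simp only [Φ]
    linarith
  rw [← hzΦ]
  refine hρ _ ⟨?_, ?_⟩
  · rw [mem_closedBall_iff_norm]
    refine Real.le_sqrt_of_sq_le ?_
    rw [le_div_iff₀ hc₁, mul_comm]
    exact (hbounds z).1.trans hV
  · rw [mem_closedBall_zero_iff]
    have hM := Real.sqrt_nonneg M
    refine (pi_norm_le_iff_of_nonneg hM).2 fun i => (pi_norm_le_iff_of_nonneg hM).2 fun k =>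
      (pi_norm_le_iff_of_nonneg hM).2 fun q => ?_
    exact (abs_disagreement_le f R z i k q).trans (Real.sqrt_le_sqrt hU)

end Dynamics

theorem isClassKL_sqrt_decayEnvelope_add_exp {a : ℝ → ℝ} (ha0 : ∀ s, 0 < s → 0 < a s)
    (ha1 : ∀ s, a s ≤ 1) {b c μ : ℝ} (hb : 0 < b) (hc : 0 < c) (hμ : 0 < μ) :
    IsClassKL fun r s => √(decayEnvelope a (b * r ^ 2) s / c) + r * Real.exp (-μ * s) where
  continuousOn := by
    have h : Continuous fun u : ℝ × ℝ => decayEnvelope a (b * u.1 ^ 2) u.2 :=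
      (decayEnvelope_lipschitz ha0 ha1).continuous.comp
        (f := fun u : ℝ × ℝ => (b * u.1 ^ 2, u.2)) (by fun_prop)
    exact ((h.div_const c).sqrt.add (by fun_prop)).continuousOn
  zero_left s hs := by simp [decayEnvelope_zero_left ha0 hs]
  strictMonoOn s hs := by
    intro r hr r' hr' hlt
    refine add_lt_add_of_le_of_lt (Real.sqrt_le_sqrt (div_le_div_of_nonneg_right ?_ hc.le))
      (mul_lt_mul_of_pos_right hlt (Real.exp_pos _))
    exact decayEnvelope_mono_left a s
      (mul_le_mul_of_nonneg_left (pow_le_pow_left₀ hr hlt.le 2) hb.le)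
  antitoneOn r hr := by
    intro s _ s' _ hle
    refine add_le_add (Real.sqrt_le_sqrt (div_le_div_of_nonneg_right ?_ hc.le))
      (mul_le_mul_of_nonneg_left (Real.exp_le_exp.2 ?_) hr)
    · exact decayEnvelope_antitone ha0 _ hle
    · nlinarith
  tendsto_zero r hr := by
    have h1 : Tendsto (fun s => √(decayEnvelope a (b * r ^ 2) s / c)) atTop (𝓝 0) := by
      simpa using ((tendsto_decayEnvelope ha0 (b * r ^ 2)).div_const c).sqrt
    have h2 : Tendsto (fun s => r * Real.exp (-μ * s)) atTop (𝓝 0) := by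
      have h3 : Tendsto (fun s : ℝ => -μ * s) atTop atBot :=
        tendsto_id.const_mul_atTop_of_neg (neg_lt_zero.2 hμ)
      simpa using (Real.tendsto_exp_atBot.comp h3).const_mul r
    simpa using h1.add h2

end CoalitionGame

theorem theorem1 (N : ℕ) (hN : 2 ≤ N) (m : Fin N → ℕ) (hm : ∀ i, 2 ≤ m i)
    (f : Costs m) (hf : ∀ i j, ContDiff ℝ 2 (f i j)) (hmono : IsStrictlyMonotone f)
    (xs : Profile m) (hxs : IsNashEquilibrium f xs)
    (C : (i : Fin N) → WeightedGraph (Fin (m i)))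
    (hI : ∀ i, (interferenceGraph f i).Connected)
    (hCu : ∀ i k, (interferenceToGraph f C i k).IsUndirected)
    (hCc : ∀ i k, (interferenceToGraph f C i k).IsConnected)
    (d : (i : Fin N) → Fin (m i) → ℝ) (hd : ∀ i j, 0 < d i j)
    (R : Frames f) (hR : ∀ i k, IsOrthogonalCompletion (R i k)) :
    ∃ φ : ℝ → ℝ → ℝ, IsClassKL φ ∧
      ∀ Δ v : ℝ, 0 < Δ → 0 < v → ∃ δs : ℝ, 0 < δs ∧ ∀ δ : ℝ, 0 < δ → δ < δs →
        ∀ x₀ : Profile m, ‖errorState f R xs x₀ 0‖ < Δ →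
          (∃ (x : ℝ → Profile m) (w : ℝ → Aux f), IsTrajectory f C d δ x₀ x w) ∧
          ∀ (x : ℝ → Profile m) (w : ℝ → Aux f), IsTrajectory f C d δ x₀ x w →
            ∀ t : ℝ, 0 ≤ t →
              ‖errorState f R xs (x t) (w t)‖ ≤
                φ ‖errorState f R xs x₀ 0‖ (δ * t) + v := by
  have hP0 := pseudoGradient_eq_zero_of_isNashEquilibrium hf hxs
  obtain ⟨c₁, c₂, hc₁, hc₂, hbounds⟩ := exists_trackingEnergy_bounds f hd xs
  obtain ⟨μ, hμ, hfast⟩ := fderiv_disagreementEnergy_fastField_le hf hCu hCc hR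
  obtain ⟨a, ha, ha0, ha1, haW⟩ := exists_monotone_minorant (X := State f)
    (V := trackingEnergy f d xs) (W := fun z => inner ℝ (z.1 - xs) (pseudoGradient f z.1))
    (fun z => by
      by_cases h : z.1 = xs
      · simp [h]
      · simpa [hP0] using (hmono z.1 xs h).le)
    (fun s hs => by
      obtain ⟨c, hc, hle⟩ := exists_pos_le_inner_pseudoGradient hf hmono hP0
        (Real.sqrt_pos.2 (div_pos hs hc₂))
      refine ⟨c, hc, fun z hz => hle z.1 (Real.sqrt_le_iff.2 ⟨norm_nonneg _, ?_⟩)⟩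
      rw [div_le_iff₀ hc₂, mul_comm]
      exact hz.trans (hbounds z).2)
  have ha0' : ∀ s, 0 < s → 0 < a s / 2 := fun s hs => half_pos (ha0 s hs)
  refine ⟨_, isClassKL_sqrt_decayEnvelope_add_exp (a := fun s => a s / 2) (b := c₂) (c := c₁)
    (μ := μ / 2) ha0' (fun s => by linarith [ha1 s]) hc₂ hc₁ (half_pos hμ),
    fun Δ v hΔ hv => ?_⟩
  obtain ⟨η, hη, hη₁, hη₂⟩ : ∃ η : ℝ, 0 < η ∧ √η ≤ v / 2 ∧ √(η / c₁) ≤ v / 2 := by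
    refine ⟨min ((v / 2) ^ 2) (c₁ * (v / 2) ^ 2), by positivity, ?_, ?_⟩
    · exact Real.sqrt_le_iff.2 ⟨by positivity, min_le_left _ _⟩
    · refine Real.sqrt_le_iff.2 ⟨by positivity, ?_⟩
      rw [div_le_iff₀ hc₁, mul_comm _ c₁]
      exact min_le_right _ _
  obtain ⟨δs, hδs, H⟩ := semiglobal_practical_stability (contDiff_slowField hf d)
    (contDiff_fastField hf C) (S := balancedStates f) (balancedStates_invariant hCu d)
    (contDiff_disagreementEnergy hf R) (contDiff_trackingEnergy f d xs)
    (disagreementEnergy_nonneg f R) (trackingEnergy_nonneg f hd xs) hμ (fun z _ => hfast z)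
    (fun z _ => by simp [fderiv_trackingEnergy, fastField]) ha ha0
    (fun M => by
      obtain ⟨c, hc, hle⟩ := fderiv_trackingEnergy_slowField_le hf hd xs hR M
      exact ⟨c, hc, fun z hz hM => (hle z hz hM).trans (by linarith [haW z])⟩)
    (exists_norm_le_of_energies_le hf hd xs hR) (c₂ * Δ ^ 2 + Δ ^ 2) η (by positivity) hη
  refine ⟨min δs 1, lt_min hδs one_pos, fun δ hδ hδlt x₀ hx₀ => ?_⟩
  set r := ‖errorState f R xs x₀ 0‖ with hr
  have hr0 : 0 ≤ r := norm_nonneg _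
  have hrsq : r ^ 2 = disagreementEnergy f R (x₀, 0) + ‖x₀ - xs‖ ^ 2 :=
    norm_errorState_sq f R xs (x₀, 0)
  have hrΔ : r ^ 2 ≤ Δ ^ 2 := pow_le_pow_left₀ hr0 hx₀.le 2
  have hU₀ : disagreementEnergy f R (x₀, 0) ≤ r ^ 2 := by
    linarith [sq_nonneg ‖x₀ - xs‖]
  have hV₀ : trackingEnergy f d xs (x₀, 0) ≤ c₂ * r ^ 2 := by
    refine (hbounds (x₀, 0)).2.trans (mul_le_mul_of_nonneg_left ?_ hc₂.le)
    linarith [disagreementEnergy_nonneg f R (x₀, 0)]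
  have hcΔ := mul_le_mul_of_nonneg_left hrΔ hc₂.le
  have hcΔ0 : 0 ≤ c₂ * Δ ^ 2 := by positivity
  obtain ⟨⟨z, hz0, hz⟩, Hest⟩ := H δ hδ (hδlt.trans_le (min_le_left _ _)) (x₀, 0)
    (fun i k => by simp) (by linarith [sq_nonneg Δ]) (by linarith)
  refine ⟨⟨fun t => (z t).1, fun t => (z t).2, isTrajectory_iff.2 ⟨hz0, hz⟩⟩,
    fun x w hxw t ht => ?_⟩
  obtain ⟨h0, hder⟩ := isTrajectory_iff.1 hxw
  obtain ⟨hV, hU⟩ := Hest (fun t => (x t, w t)) h0 hder t ht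
  have hUr : √(disagreementEnergy f R (x t, w t)) ≤
      r * Real.exp (-(μ / 2) * (δ * t)) + v / 2 := by
    have h1 : disagreementEnergy f R (x t, w t) ≤ r ^ 2 * Real.exp (-μ * t) + η :=
      hU.trans (by gcongr)
    refine (Real.sqrt_le_sqrt h1).trans
      ((sqrt_add_le_add_sqrt (by positivity) hη.le).trans (add_le_add ?_ hη₁))
    rw [Real.sqrt_mul (sq_nonneg r), Real.sqrt_sq hr0, ← Real.exp_half]
    refine mul_le_mul_of_nonneg_left (Real.exp_le_exp.2 ?_) hr0
    have h2 : δ * t ≤ 1 * t :=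
      mul_le_mul_of_nonneg_right (hδlt.trans_le (min_le_right _ _)).le ht
    nlinarith
  have hVr : ‖x t - xs‖ ≤
      √(decayEnvelope (fun s => a s / 2) (c₂ * r ^ 2) (δ * t) / c₁) + v / 2 := by
    have h1 : ‖x t - xs‖ ^ 2 ≤
        decayEnvelope (fun s => a s / 2) (c₂ * r ^ 2) (δ * t) / c₁ + η / c₁ := by
      rw [← add_div, le_div_iff₀ hc₁, mul_comm]
      refine (hbounds (x t, w t)).1.trans (hV.trans (add_le_add ?_ le_rfl))
      exact decayEnvelope_mono_left _ _ hV₀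
    refine (Real.le_sqrt_of_sq_le h1).trans ((sqrt_add_le_add_sqrt
      (div_nonneg (decayEnvelope_nonneg _ _ _) hc₁.le) (by positivity)).trans
      (add_le_add le_rfl hη₂))
  have hχ : ‖errorState f R xs (x t) (w t)‖ ≤
      √(disagreementEnergy f R (x t, w t)) + ‖x t - xs‖ := by
    have h1 := Real.le_sqrt_of_sq_le (norm_errorState_sq f R xs (x t, w t)).le
    refine h1.trans ((sqrt_add_le_add_sqrt (disagreementEnergy_nonneg f R _)
      (sq_nonneg _)).trans ?_)
    rw [Real.sqrt_sq (norm_nonneg _)]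
  linarith
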